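/- **Notation.** For a positive integer $n$ put $[n]=\{1,\dots,n\}$. Let $(X_i,\Sigma_i,\mu_i)$, $i\in[n]$, be probability spaces with product $(\boldsymbol X,\boldsymbol\Sigma,\boldsymbol\mu)$; for $e\subseteq[n]$ let $(\boldsymbol X_e,\boldsymbol\Sigma_e,\boldsymbol\mu_e)$ be the product of the spaces with $i\in e$, let $\pi_e\colon\boldsymbol X\to\boldsymbol X_e$ be the projection, and put $\mathcal B_e=\{\pi_e^{-1}(A):A\in\boldsymbol\Sigma_e\}$. A $\mathcal B_e$-measurable $f\colon\boldsymbol X\to\mathbb R$ is $f=\mathbf f\circ\pi_e$ for a unique $\mathbf f\colon\boldsymbol X_e\to\mathbb R$. For $\boldsymbol x_e^{(0)},\dots,\boldsymbol x_e^{(\ell-1)}\in\boldsymbol X_e$ and $\omega\in\{0,\dots,\ell-1\}^e$ put $\boldsymbol x_e^{(\omega)}=(x_i^{(\omega_i)})_{i\in e}$; for points $\boldsymbol x^{(0)},\dots,\boldsymbol x^{(\ell-1)}\in\boldsymbol X$, $\boldsymbol x_e^{(\omega)}$ is formed in the same way from their coordinates in $e$. For even $\ell\ge 2$ let $$\|\mathbf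 f\|_{\square_\ell(\boldsymbol X_e)}=\mathbb E\Big[\prod_{\omega\in\{0,\dots,\ell-1\}^e}\mathbf f(\boldsymbol x_e^{(\omega)})\,\Big|\,\boldsymbol x_e^{(0)},\dots,\boldsymbol x_e^{(\ell-1)}\in\boldsymbol X_e\Big]^{1/\ell^{|e|}}$$ (to be read as $\infty$ if the product is not integrable), $\|\mathbf f\|_{\square_{\ell,p}(\boldsymbol X_e)}=\big\||\mathbf f|^p\big\|_{\square_\ell(\boldsymbol X_e)}^{1/p}$ for $1\le p<\infty$, and $\|\mathbf f\|_{\square_{\ell,\infty}(\boldsymbol X_e)}=\|\mathbf f\|_{L_\infty}$. For $C\ge 1$ and $1<p\le\infty$ with conjugate exponent $q$, let $\ell(C,p)$ be the least even natural number that is at least $2q+(1-\tfrac1C)+\tfrac1p$ (where $1/\infty=0$). **Pseudorandom families.** Let $\mathcal H$ be an $r$-uniform hypergraph on $[n]$ with $n\ge r\ge 2$, let $C\ge 1$, $\eta>0$, $1<p\le\infty$, and for every $e\in\mathcal H$ let $\nu_e\in L_1(\boldsymbol X,\mathcal B_e,\boldsymbol\mu)$ be nonnegative. The family $\langle\nu_e:e\in\mathcal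 H\rangle$ is *$(C,\eta,p)$-pseudorandom* if the following hold, all the expectations below being those of integrable functions. * (C1) $\mathbb E\big[\prod_{e\in\mathcal G}\nu_e\big]\ge 1-\eta$ for every nonempty $\mathcal G\subseteq\mathcal H$. * (C2) For every $e\in\mathcal H$ there is $\psi_e\in L_p(\boldsymbol X,\mathcal B_e,\boldsymbol\mu)$ with $\|\psi_e\|_{L_p}\le C$ such that: (a) $\big|\int_A(\nu_e-\psi_e)\,d\boldsymbol\mu\big|\le\eta$ for every set $A=\bigcap_{f}A_{f}$, the intersection being over all $f\subseteq e$ with $|f|=|e|-1$, where $A_f\in\mathcal B_f$; (b) for all $g_{e'}^{(\omega)}\in L_1(\boldsymbol X,\mathcal B_{e'},\boldsymbol\mu)$ ($e'\in\mathcal H\setminus\{e\}$, $\omega\in\{0,1\}$), each satisfying $0\le g_{e'}^{(\omega)}\le\nu_{e'}$ or $0\le g_{e'}^{(\omega)}\le 1$, $$\Big|\mathbb E\Big[(\boldsymbol\nu_e-\boldsymbol\psi_e)(\boldsymbol x_e)\prod_{\omega\in\{0,1\}}\mathbb E\Big[\prod_{e'\in\mathcal H\setminus\{e\}}g_{e'}^{(\omega)}(\boldsymbol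 x_e,\boldsymbol x_{[n]\setminus e})\,\Big|\,\boldsymbol x_{[n]\setminus e}\in\boldsymbol X_{[n]\setminus e}\Big]\,\Big|\,\boldsymbol x_e\in\boldsymbol X_e\Big]\Big|\le\eta.$$ * (C3) For every $e\in\mathcal H$ and every nonempty $\mathcal G\subseteq\mathcal H\setminus\{e\}$, the function $\boldsymbol\nu_{e,\mathcal G}(\boldsymbol x_e)=\mathbb E\big[\prod_{e'\in\mathcal G}\nu_{e'}(\boldsymbol x_e,\boldsymbol x_{[n]\setminus e})\,\big|\,\boldsymbol x_{[n]\setminus e}\in\boldsymbol X_{[n]\setminus e}\big]$ satisfies $\mathbb E\big[\boldsymbol\nu_{e,\mathcal G}^{\,\ell(C,p)}\big]\le C+\eta$. **Theorem 4.3.** Let $n\ge 3$ be an integer, $C\ge1$, $1<p\le\infty$, $\ell=\ell(C,p)$ and $0<\eta\le 1/(n\ell)$. Let $(X_i,\Sigma_i,\mu_i)$, $i\in[n]$, be probability spaces and let $\mathcal H=\binom{[n]}{n-1}$ be the complete $(n-1)$-uniform hypergraph on $[n]$. For every $e\in\mathcal H$ let $\nu_e\in L_1(\boldsymbol X,\mathcal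 B_e,\boldsymbol\mu)$ and $\psi_e\in L_p(\boldsymbol X,\mathcal B_e,\boldsymbol\mu)$ be nonnegative. Assume the following. * (I) For every choice of $n_{e,\omega}\in\{0,1\}$ (for $e\in\mathcal H$ and $\omega\in\{0,\dots,\ell-1\}^e$), $$1-\eta\le\mathbb E\Big[\prod_{e\in\mathcal H}\ \prod_{\omega\in\{0,\dots,\ell-1\}^e}\boldsymbol\psi_e^{\,n_{e,\omega}}(\boldsymbol x_e^{(\omega)})\,\Big|\,\boldsymbol x^{(0)},\dots,\boldsymbol x^{(\ell-1)}\in\boldsymbol X\Big]\le C+\eta .$$ * (II) For every $e\in\mathcal H$ we have $1\le\|\boldsymbol\nu_e\|_{\square_{\ell,p}(\boldsymbol X_e)}<\infty$, $\|\boldsymbol\psi_e\|_{\square_{\ell,p}(\boldsymbol X_e)}\le C$ and $$\|\boldsymbol\nu_e-\boldsymbol\psi_e\|_{\square_\ell(\boldsymbol X_e)}\le\eta\,(C\cdot M)^{-(n-1)\ell},\qquad M=\max\{\|\boldsymbol\nu_{e'}\|_{\square_{\ell,p}(\boldsymbol X_{e'})}:e'\in\mathcal H\}.$$ Then the family $\langle\nu_e:e\in\mathcal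 H\rangle$ is $(C,n\ell\eta,p)$-pseudorandom. -/

import Mathlib

open MeasureTheory
open scoped ENNReal

noncomputable section

namespace HypergraphSystem

universe u

variable {n : ℕ} {X : Fin n → Type u}

/-- The product space `X_e = ∏_{i ∈ e} X_i`. -/
abbrev ProdSpace (X : Fin n → Type u) (e : Finset (Fin n)) : Type u := (i : e) → X i

/-- The natural projection `π_e` of the full product onto `X_e`. -/
def proj (e : Finset (Fin n)) (x : (i : Fin n) → X i) : ProdSpace X e := fun i => x i

/-- The point `(x_e, y)` of the full product, for `x_e ∈ X_e` and `y ∈ X_{[n] \ e}`. -/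
def glue (e : Finset (Fin n)) (x : ProdSpace X e) (y : ProdSpace X eᶜ) : (i : Fin n) → X i :=
  fun i => if h : i ∈ e then x ⟨i, h⟩ else y ⟨i, Finset.mem_compl.2 h⟩

/-- The point `x_e^{(ω)} = (x_i^{(ω_i)})_{i ∈ e}` built from `x_e^{(0)}, …, x_e^{(ℓ-1)}`. -/
def mix {e : Finset (Fin n)} {ℓ : ℕ} (ω : e → Fin ℓ) (x : Fin ℓ → ProdSpace X e) : ProdSpace X e :=
  fun i => x (ω i) i

/-- For a function `f` on the full product that depends only on the coordinates in `e`, the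
function `𝐟` on `X_e` with `f = 𝐟 ∘ π_e` (see `descend_comp_proj` and `descend_unique`). -/
def descend (e : Finset (Fin n)) (f : ((i : Fin n) → X i) → ℝ) : ProdSpace X e → ℝ :=
  Function.extend (proj e) f 0

variable [∀ i, MeasurableSpace (X i)]

/-- The lifted σ-algebra `𝓑_e = {π_e⁻¹(A) : A ∈ Σ_e}` on the full product. -/
abbrev sigmaAlg (X : Fin n → Type u) [∀ i, MeasurableSpace (X i)] (e : Finset (Fin n)) :
    MeasurableSpace ((i : Fin n) → X i) :=
  MeasurableSpace.comap (proj e) (inferInstance : MeasurableSpace (ProdSpace X e))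

/-- The product measure on `X_e`. -/
def prodMeasure (μ : (i : Fin n) → Measure (X i)) (e : Finset (Fin n)) : Measure (ProdSpace X e) :=
  Measure.pi fun i : e => μ i

/-- `f ∈ L_p(X, 𝓑_e, μ)`, where `X` is the full product. -/
def MemLpAlg (μ : (i : Fin n) → Measure (X i)) (e : Finset (Fin n)) (p : ℝ≥0∞)
    (f : ((i : Fin n) → X i) → ℝ) : Prop :=
  Measurable[sigmaAlg X e] f ∧ MemLp f p (Measure.pi μ)

/-- The `ℓ`-box norm of `f : X_e → ℝ`, namely `E[∏_ω f(x_e^{(ω)})]^{1/ℓ^{|e|}}`; it is `∞` when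
the expectation is not an absolutely convergent integral. -/
def boxNorm (μ : (i : Fin n) → Measure (X i)) (e : Finset (Fin n)) (ℓ : ℕ) (f : ProdSpace X e → ℝ) :
    ℝ≥0∞ :=
  open Classical in
  if Integrable (fun x : Fin ℓ → ProdSpace X e => ∏ ω : e → Fin ℓ, f (mix ω x))
      (Measure.pi fun _ => prodMeasure μ e) then
    ENNReal.ofReal
      ((∫ x : Fin ℓ → ProdSpace X e, ∏ ω : e → Fin ℓ, f (mix ω x)
        ∂(Measure.pi fun _ => prodMeasure μ e)) ^ (1 / ((ℓ : ℝ) ^ e.card)))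
  else ⊤

/-- The `(ℓ, p)`-box norm `‖ |f|^p ‖^{1/p}`, which for `p = ∞` is the `L_∞` norm. -/
def boxNormLp (μ : (i : Fin n) → Measure (X i)) (e : Finset (Fin n)) (ℓ : ℕ) (p : ℝ≥0∞)
    (f : ProdSpace X e → ℝ) : ℝ≥0∞ :=
  if p = ⊤ then eLpNorm f ⊤ (prodMeasure μ e)
  else boxNorm μ e ℓ (fun x => |f x| ^ p.toReal) ^ (1 / p.toReal)

/-- The family `∂e` of the subsets of `e` with `|e| - 1` elements. -/
def boundary (e : Finset (Fin n)) : Finset (Finset (Fin n)) := e.powersetCard (e.card - 1)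

/-- The family of the sets `⋂_{e' ∈ ∂e} A_{e'}` with `A_{e'} ∈ 𝓑_{e'}`. -/
def cutSets (X : Fin n → Type u) [∀ i, MeasurableSpace (X i)] (e : Finset (Fin n)) :
    Set (Set ((i : Fin n) → X i)) :=
  {S | ∃ A : Finset (Fin n) → Set ((i : Fin n) → X i),
    (∀ e' ∈ boundary e, MeasurableSet[sigmaAlg X e'] (A e')) ∧ S = ⋂ e' ∈ boundary e, A e'}

/-- The cut norm of `f`. -/
def cutNorm (μ : (i : Fin n) → Measure (X i)) (e : Finset (Fin n))
    (f : ((i : Fin n) → X i) → ℝ) : ℝ :=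
  sSup ((fun A => |∫ x in A, f x ∂(Measure.pi μ)|) '' cutSets X e)

/-- The least even integer `ℓ` with `ℓ ≥ 2q + (1 - 1/C) + 1/p`, where `q` is the conjugate
exponent of `p`, and `1/p = 0` for `p = ∞`. -/
def boxLevel (C : ℝ) (p : ℝ≥0∞) : ℕ :=
  sInf {m : ℕ | Even m ∧ 2 * p.conjExponent.toReal + (1 - 1 / C) + (1 / p).toReal ≤ m}

/-- The average `E[∏_{e' ∈ 𝓖} g_{e'}(x_e, y) | y ∈ X_{[n] \ e}]`, as a function of `x_e`. -/
def fibreAverage (μ : (i : Fin n) → Measure (X i)) (e : Finset (Fin n))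
    (G : Finset (Finset (Fin n))) (g : Finset (Fin n) → ((i : Fin n) → X i) → ℝ)
    (x : ProdSpace X e) : ℝ :=
  ∫ y : ProdSpace X eᶜ, ∏ e' ∈ G, g e' (glue e x y) ∂(prodMeasure μ eᶜ)

/-- The family `⟨ν_e : e ∈ 𝓗⟩` is `(C, η, p)`-pseudorandom. Every expectation is required to be that
of an integrable function, so that none of the bounds refers to a default value. -/
structure IsPseudorandom (μ : (i : Fin n) → Measure (X i)) (H : Finset (Finset (Fin n)))
    (C η : ℝ) (p : ℝ≥0∞) (ν : Finset (Fin n) → ((i : Fin n) → X i) → ℝ) : Prop where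
  uniform : ∃ r : ℕ, 2 ≤ r ∧ r ≤ n ∧ ∀ e ∈ H, e.card = r
  memL1 : ∀ e ∈ H, MemLpAlg μ e 1 (ν e)
  nonneg : ∀ e ∈ H, ∀ x, 0 ≤ ν e x
  C1 : ∀ G ⊆ H, G.Nonempty →
    Integrable (fun x => ∏ e ∈ G, ν e x) (Measure.pi μ) ∧
      1 - η ≤ ∫ x, ∏ e ∈ G, ν e x ∂(Measure.pi μ)
  C2 : ∀ e ∈ H, ∃ ψ : ((i : Fin n) → X i) → ℝ,
    MemLpAlg μ e p ψ ∧ eLpNorm ψ p (Measure.pi μ) ≤ ENNReal.ofReal C ∧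
    cutNorm μ e (fun x => ν e x - ψ x) ≤ η ∧
    ∀ g : Fin 2 → Finset (Fin n) → ((i : Fin n) → X i) → ℝ,
      (∀ ω, ∀ e' ∈ H.erase e, MemLpAlg μ e' 1 (g ω e') ∧
        ((∀ x, 0 ≤ g ω e' x ∧ g ω e' x ≤ ν e' x) ∨ (∀ x, 0 ≤ g ω e' x ∧ g ω e' x ≤ 1))) →
      Integrable (fun x : ProdSpace X e => (descend e (ν e) x - descend e ψ x) *
        ∏ ω : Fin 2, fibreAverage μ e (H.erase e) (g ω) x) (prodMeasure μ e) ∧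
      |∫ x : ProdSpace X e, (descend e (ν e) x - descend e ψ x) *
        ∏ ω : Fin 2, fibreAverage μ e (H.erase e) (g ω) x ∂(prodMeasure μ e)| ≤ η
  C3 : ∀ e ∈ H, ∀ G ⊆ H.erase e, G.Nonempty →
    Integrable (fun x => fibreAverage μ e G ν x ^ boxLevel C p) (prodMeasure μ e) ∧
      ∫ x, fibreAverage μ e G ν x ^ boxLevel C p ∂(prodMeasure μ e) ≤ C + η

/-- The complete `(n-1)`-uniform hypergraph on `[n]`. -/
def completeHypergraph (n : ℕ) : Finset (Finset (Fin n)) :=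
  (Finset.univ : Finset (Fin n)).powersetCard (n - 1)

theorem proj_surjective {n : ℕ} {X : Fin n → Type u} [∀ i, Nonempty (X i)]
    (e : Finset (Fin n)) : Function.Surjective (proj (X := X) e) := by
  classical
  intro y
  refine ⟨fun i => if h : i ∈ e then y ⟨i, h⟩ else Classical.arbitrary _, ?_⟩
  funext i
  simp [proj]

/-- `f ↦ 𝐟` inverts composition with `π_e`; so `𝐟` is determined by `f = 𝐟 ∘ π_e`. -/
theorem descend_unique {n : ℕ} {X : Fin n → Type u} [∀ i, Nonempty (X i)]
    (e : Finset (Fin n)) (F : ProdSpace X e → ℝ) : descend e (F ∘ proj e) = F := by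
  funext y
  obtain ⟨x, rfl⟩ := proj_surjective (X := X) e y
  have h : Function.FactorsThrough (F ∘ proj e) (proj (X := X) e) := fun a b hab => by
    simp [hab]
  exact h.extend_apply 0 x

/-- A `𝓑_e`-measurable `f` equals `𝐟 ∘ π_e` with `𝐟` measurable. -/
theorem descend_comp_proj {n : ℕ} {X : Fin n → Type u} [∀ i, MeasurableSpace (X i)]
    [∀ i, Nonempty (X i)] (e : Finset (Fin n)) (f : ((i : Fin n) → X i) → ℝ)
    (hf : Measurable[sigmaAlg X e] f) :
    Measurable (descend e f) ∧ f = descend e f ∘ proj e := by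
  obtain ⟨F, hF, rfl⟩ := Measurable.exists_eq_measurable_comp hf
  rw [descend_unique]
  exact ⟨hF, rfl⟩

end HypergraphSystem

end

open HypergraphSystem

/-! Everything rests on a generalised von Neumann inequality. Give each coordinate `ℓ` independent
copies. Let `F` live on the edge `[n] \ {j}`, and for `i ≠ j` and each copy `k` of the coordinate
`j` let `g i k` be a function that ignores the coordinate `i`, evaluated with the `k`-th copy of
`j`. If every `g i k` has (ℓ, s)-box norm at most `K`, where `s` is the conjugate exponent of `ℓ`,
then the average of `F · ∏ g i k` is at most the ℓ-box norm of `F` times `K ^ (ℓ(n-1))`.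

To prove it, remove the coordinates `i ≠ j` one at a time. The factors `g i k` ignore `i`, so
averaging over `i` falls on the rest of the product alone. Hölder with exponents `s` and `ℓ` splits
off those factors, and the ℓ-th power of the remaining average unfolds into a product over the `ℓ`
copies of `i`. After all steps `F` is duplicated in every coordinate of its edge, which is its box
norm. As `ℓ` is even, the ℓ-th power of a signed average is nonnegative, so no absolute value enters
the integrand and the cancellation in `F` survives. A second Hölder, over the copies of `j`, bounds
the split-off factors by `K`. This is `BoxBounded.integral_mul_prod_le`;
`integral_prod_prod_freeze_le` is the variant in which the small factor sits on an edge through `j`.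

The choice of `ℓ` gives `s ≤ p`, so (ℓ, p)-box norms control (ℓ, s)-box norms, and `K = C·M` serves
all the `ν` and `ψ`. The bound on `ν - ψ` in (II) is such that replacing one factor `ν` by `ψ` costs
at most `η`. For (C1) there are `n` replacements; for (C3), written as an average over `ℓ` copies of
`j`, there are `(n-1)ℓ`; what remains is a linear form in `ψ`, handled by (I). For (C2) the
inequality is applied directly with `F = ν_e - ψ_e`, the other factors being indicators or the given
`g`. -/

noncomputable section

namespace HypergraphSystem

universe u

/-! ### Combinatorics of freezing and duplicating coordinates. -/

section Duplication

variable {ι : Type*} [DecidableEq ι] {X : ι → Type*} {ℓ : ℕ}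

/-- Families consisting of `ℓ` copies of every coordinate. -/
abbrev Copies (X : ι → Type*) (ℓ : ℕ) := (i : ι) → Fin ℓ → X i

/-- Replace all the copies of the coordinate `i` by the `k`-th one. -/
def freeze (i : ι) (k : Fin ℓ) (z : Copies X ℓ) : Copies X ℓ :=
  Function.update z i (fun _ => z i k)

/-- Replace, for every `i ∈ S`, all the copies of the coordinate `i` by the `ω i`-th one. -/
def select (S : Finset ι) (ω : ι → Fin ℓ) (z : Copies X ℓ) : Copies X ℓ :=
  fun i => if i ∈ S then fun _ => z i (ω i) else z i

/-- The choices of a copy for every coordinate in `S`. -/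
def choices [Fintype ι] [NeZero ℓ] (S : Finset ι) : Finset (ι → Fin ℓ) :=
  Fintype.piFinset fun i => if i ∈ S then Finset.univ else {0}

/-- The product of `Φ` over all choices of copies of the coordinates in `S`. -/
def dup [Fintype ι] [NeZero ℓ] {R : Type*} [CommMonoid R] (S : Finset ι) (Φ : Copies X ℓ → R)
    (z : Copies X ℓ) : R :=
  ∏ ω ∈ choices S, Φ (select S ω z)

theorem select_empty (ω : ι → Fin ℓ) (z : Copies X ℓ) : select ∅ ω z = z := by
  funext i; simp [select]

theorem select_update_of_notMem {S : Finset ι} {i : ι} (hi : i ∉ S) (ω : ι → Fin ℓ)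
    (z : Copies X ℓ) (w : Fin ℓ → X i) :
    select S ω (Function.update z i w) = Function.update (select S ω z) i w := by
  funext j
  by_cases hj : j = i
  · subst hj; simp [select, hi]
  · simp [select, hj]

theorem select_insert {S : Finset ι} {i : ι} (hi : i ∉ S) (ω : ι → Fin ℓ) (k : Fin ℓ)
    (z : Copies X ℓ) :
    select (insert i S) (Function.update ω i k) z = select S ω (freeze i k z) := by
  rw [freeze, select_update_of_notMem hi]
  funext j
  by_cases hj : j = i
  · subst hj; simp [select]
  · simp [select, hj]

theorem freeze_update (i : ι) (k : Fin ℓ) (z : Copies X ℓ) (w : Fin ℓ → X i) :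
    freeze i k (Function.update z i w) = Function.update z i (fun _ => w k) := by
  simp [freeze]

theorem select_freeze_of_notMem {S : Finset ι} {i : ι} (hi : i ∉ S) (ω : ι → Fin ℓ) (k : Fin ℓ)
    (z : Copies X ℓ) : select S ω (freeze i k z) = freeze i k (select S ω z) := by
  rw [freeze, select_update_of_notMem hi, freeze]
  simp [select, hi]

theorem update_freeze_of_ne {i j : ι} (h : i ≠ j) (k : Fin ℓ) (z : Copies X ℓ)
    (w : Fin ℓ → X j) :
    freeze i k (Function.update z j w) = Function.update (freeze i k z) j w := by
  simp [freeze, Function.update_comm h, Function.update_of_ne h]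

variable [Fintype ι] [NeZero ℓ] {R : Type*} [CommMonoid R]

/-- Choices are normalised to `0` outside `S`, so a choice on `insert i S` arises exactly once by
overwriting the value at `i` of a choice on `S`. -/
theorem prod_choices_insert {S : Finset ι} {i : ι} (hi : i ∉ S) (f : (ι → Fin ℓ) → R) :
    ∏ ω ∈ choices (insert i S), f ω = ∏ k, ∏ ω ∈ choices S, f (Function.update ω i k) := by
  rw [Finset.prod_comm, ← Finset.prod_product']
  symm
  refine Finset.prod_bij' (fun a _ => Function.update a.1 i a.2)
    (fun ω _ => (Function.update ω i 0, ω i)) ?_ ?_ ?_ ?_ ?_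
  · rintro ⟨ω, k⟩ h
    simp only [choices, Finset.mem_product, Fintype.mem_piFinset, Finset.mem_insert] at h ⊢
    intro j
    by_cases hj : j = i
    · subst hj; simp
    · simpa [hj] using h.1 j
  · intro ω h
    simp only [choices, Finset.mem_product, Fintype.mem_piFinset, Finset.mem_insert,
      Finset.mem_univ, and_true] at h ⊢
    intro j
    by_cases hj : j = i
    · subst hj; simp [hi]
    · simpa [hj] using h j
  · rintro ⟨ω, k⟩ h
    simp only [choices, Finset.mem_product, Fintype.mem_piFinset] at h
    have := h.1 i
    simp only [hi, if_false, Finset.mem_singleton] at this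
    simp [← this]
  · intro ω h
    simp
  · intro a h
    rfl

theorem dup_empty (Φ : Copies X ℓ → R) : dup ∅ Φ = Φ := by
  funext z
  have : (choices ∅ : Finset (ι → Fin ℓ)) = {0} := by
    ext ω; simp [choices, funext_iff]
  simp [dup, this, select_empty]

/-- The recursion behind every Hölder step: the ℓ-th power of an average over `i` unfolds into
precisely such a product over the copies of `i`. -/
theorem dup_insert {S : Finset ι} {i : ι} (hi : i ∉ S) (Φ : Copies X ℓ → R) (z : Copies X ℓ) :
    dup (insert i S) Φ z = ∏ k, dup S Φ (freeze i k z) := by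
  simp only [dup]
  rw [prod_choices_insert hi]
  simp only [select_insert hi]

theorem dup_freeze_of_notMem {S : Finset ι} {i : ι} (hi : i ∉ S) (Φ : Copies X ℓ → R) (k : Fin ℓ)
    (z : Copies X ℓ) : dup S Φ (freeze i k z) = dup S (fun z => Φ (freeze i k z)) z := by
  simp only [dup, select_freeze_of_notMem hi]

theorem dup_update_of_notMem {S : Finset ι} {i : ι} (hi : i ∉ S) (Φ : Copies X ℓ → R)
    (z : Copies X ℓ) (w : Fin ℓ → X i) :
    dup S Φ (Function.update z i w) = dup S (fun z => Φ (Function.update z i w)) z := by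
  simp only [dup, select_update_of_notMem hi]

theorem dup_mul (S : Finset ι) (Φ Ψ : Copies X ℓ → R) (z : Copies X ℓ) :
    dup S (fun z => Φ z * Ψ z) z = dup S Φ z * dup S Ψ z := by
  simp only [dup, Finset.prod_mul_distrib]

theorem dup_prod {α : Type*} (S : Finset ι) (T : Finset α) (Φ : α → Copies X ℓ → R)
    (z : Copies X ℓ) : dup S (fun z => ∏ a ∈ T, Φ a z) z = ∏ a ∈ T, dup S (Φ a) z := by
  simp only [dup]
  rw [Finset.prod_comm]

theorem enorm_dup (S : Finset ι) (Φ : Copies X ℓ → ℝ) (z : Copies X ℓ) :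
    ‖dup S Φ z‖ₑ = dup S (fun z => ‖Φ z‖ₑ) z := by
  simp only [dup]
  induction choices (ℓ := ℓ) S using Finset.cons_induction with
  | empty => simp
  | cons a s ha ih => rw [Finset.prod_cons, Finset.prod_cons, enorm_mul, ih]

theorem dup_rpow (S : Finset ι) (Φ : Copies X ℓ → ℝ≥0∞) {s : ℝ} (hs : 0 ≤ s) (z : Copies X ℓ) :
    dup S (fun z => Φ z ^ s) z = dup S Φ z ^ s := by
  simp only [dup, ENNReal.prod_rpow_of_nonneg hs]

theorem card_choices (S : Finset ι) : (choices (ℓ := ℓ) S).card = ℓ ^ S.card := by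
  simp only [choices, Fintype.card_piFinset, apply_ite Finset.card, Finset.card_univ,
    Fintype.card_fin, Finset.card_singleton]
  rw [Finset.prod_ite]
  simp

end Duplication

/-! ### Independent copies and averaging over one coordinate. -/

section Measure

variable {ι : Type*} [Fintype ι] [DecidableEq ι] {X : ι → Type*} [∀ i, MeasurableSpace (X i)]
  {ℓ : ℕ}

omit [Fintype ι] in
theorem measurable_freeze (i : ι) (k : Fin ℓ) :
    Measurable (freeze i k : Copies X ℓ → Copies X ℓ) := by
  refine measurable_pi_lambda _ fun j => ?_
  by_cases hj : j = i
  · subst hj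
    simp only [freeze, Function.update_self]
    fun_prop
  · simp only [freeze, Function.update_of_ne hj]
    fun_prop

omit [Fintype ι] in
theorem measurable_select (S : Finset ι) (ω : ι → Fin ℓ) :
    Measurable (select S ω : Copies X ℓ → Copies X ℓ) := by
  refine measurable_pi_lambda _ fun j => ?_
  by_cases hj : j ∈ S
  · simp only [select, hj, if_true]
    fun_prop
  · simp only [select, hj, if_false]
    fun_prop

theorem measurable_dup [NeZero ℓ] {R : Type*} [CommMonoid R] [MeasurableSpace R] [MeasurableMul₂ R]
    (S : Finset ι) {Φ : Copies X ℓ → R} (hΦ : Measurable Φ) : Measurable (dup S Φ) :=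
  Finset.measurable_fun_prod _ fun ω _ => hΦ.comp (measurable_select S ω)

variable (μ : (i : ι) → Measure (X i)) [∀ i, IsProbabilityMeasure (μ i)]

/-- The measure under which all the copies of all the coordinates are independent. -/
def copyMeasure (ℓ : ℕ) : Measure (Copies X ℓ) :=
  Measure.pi fun i => Measure.pi fun _ : Fin ℓ => μ i

instance : IsProbabilityMeasure (copyMeasure μ ℓ) := by
  unfold copyMeasure; infer_instance

/-- Resampling one independent coordinate keeps the law. This lets Fubini isolate a coordinate
without splitting the index set. -/
theorem measurePreserving_update {α : ι → Type*} [∀ i, MeasurableSpace (α i)]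
    (m : (i : ι) → Measure (α i)) [∀ i, IsProbabilityMeasure (m i)] (i : ι) :
    MeasurePreserving (fun q : ((i : ι) → α i) × α i => Function.update q.1 i q.2)
      ((Measure.pi m).prod (m i)) (Measure.pi m) := by
  refine ⟨measurable_update', ?_⟩
  refine (Measure.pi_eq fun s hs => ?_).symm
  rw [Measure.map_apply measurable_update' (MeasurableSet.univ_pi hs)]
  have : (fun q : ((i : ι) → α i) × α i => Function.update q.1 i q.2) ⁻¹' Set.univ.pi s =
      (Set.univ.pi (Function.update s i Set.univ)) ×ˢ s i := by
    ext ⟨z, w⟩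
    simp only [Set.mem_preimage, Set.mem_univ_pi, Set.mem_prod]
    constructor
    · intro h
      refine ⟨fun j => ?_, by simpa using h i⟩
      by_cases hj : j = i
      · subst hj; simp
      · simpa [hj] using h j
    · rintro ⟨h1, h2⟩ j
      by_cases hj : j = i
      · subst hj; simpa using h2
      · simpa [hj] using h1 j
  rw [this, Measure.prod_prod, Measure.pi_pi, ← Finset.mul_prod_erase _ _ (Finset.mem_univ i),
    ← Finset.mul_prod_erase _ (fun j => m j (s j)) (Finset.mem_univ i)]
  simp only [Function.update_self, measure_univ, one_mul]
  rw [mul_comm]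
  congr 1
  refine Finset.prod_congr rfl fun j hj => ?_
  rw [Function.update_of_ne (Finset.ne_of_mem_erase hj)]

theorem lintegral_prod_pi {κ : Type*} [Fintype κ] {α : κ → Type*} [∀ k, MeasurableSpace (α k)]
    (m : (k : κ) → Measure (α k)) [∀ k, IsProbabilityMeasure (m k)] (f : (k : κ) → α k → ℝ≥0∞)
    (hf : ∀ k, Measurable (f k)) :
    ∫⁻ w, ∏ k, f k (w k) ∂(Measure.pi m) = ∏ k, ∫⁻ x, f k x ∂(m k) := by
  have h := ProbabilityTheory.lintegral_prod_eq_prod_lintegral_of_indepFun Finset.univ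
    (fun k (w : (k : κ) → α k) => f k (w k))
    (ProbabilityTheory.iIndepFun_pi (μ := m) fun k => (hf k).aemeasurable)
    (fun k => (hf k).comp (measurable_pi_apply k))
  rw [h]
  exact Finset.prod_congr rfl fun k _ => (measurePreserving_eval (μ := m) k).lintegral_comp (hf k)

/-- The average of `E` over the coordinate `i`, all of whose copies are equal. -/
def average (i : ι) (E : Copies X ℓ → ℝ) (z : Copies X ℓ) : ℝ :=
  ∫ x, E (Function.update z i fun _ => x) ∂(μ i)

/-- The average of `E` over the coordinate `i`, all of whose copies are equal. -/
def laverage (i : ι) (E : Copies X ℓ → ℝ≥0∞) (z : Copies X ℓ) : ℝ≥0∞ :=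
  ∫⁻ x, E (Function.update z i fun _ => x) ∂(μ i)

omit [Fintype ι] in
theorem measurable_update_const (i : ι) :
    Measurable fun q : Copies X ℓ × X i => Function.update q.1 i fun _ => q.2 := by
  have h : Measurable fun q : Copies X ℓ × X i => (q.1, fun _ : Fin ℓ => q.2) := by fun_prop
  exact measurable_update'.comp h

omit [Fintype ι] in
theorem measurable_average (i : ι) {E : Copies X ℓ → ℝ} (hE : Measurable E) :
    Measurable (average μ i E) :=
  ((hE.comp (measurable_update_const i)).stronglyMeasurable.integral_prod_right').measurable

omit [Fintype ι] in
theorem measurable_laverage (i : ι) {E : Copies X ℓ → ℝ≥0∞} (hE : Measurable E) :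
    Measurable (laverage μ i E) :=
  (hE.comp (measurable_update_const i)).lintegral_prod_right'

theorem lintegral_update (i : ι) {f : Copies X ℓ → ℝ≥0∞} (hf : Measurable f) :
    ∫⁻ z, f z ∂(copyMeasure μ ℓ) =
      ∫⁻ z, ∫⁻ w, f (Function.update z i w) ∂(Measure.pi fun _ => μ i) ∂(copyMeasure μ ℓ) := by
  have h := measurePreserving_update (fun i => Measure.pi fun _ : Fin ℓ => μ i) i
  rw [copyMeasure, ← h.lintegral_comp hf]
  exact lintegral_prod _ (hf.comp h.measurable).aemeasurable

theorem integrable_update (i : ι) {f : Copies X ℓ → ℝ} (hf : Measurable f)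
    (hint : Integrable f (copyMeasure μ ℓ)) :
    Integrable (fun q : Copies X ℓ × (Fin ℓ → X i) => f (Function.update q.1 i q.2))
      ((copyMeasure μ ℓ).prod (Measure.pi fun _ => μ i)) :=
  ((measurePreserving_update (fun i => Measure.pi fun _ : Fin ℓ => μ i) i).integrable_comp
    hf.aestronglyMeasurable).2 hint

theorem integral_update (i : ι) {f : Copies X ℓ → ℝ} (hf : Measurable f)
    (hint : Integrable f (copyMeasure μ ℓ)) :
    ∫ z, f z ∂(copyMeasure μ ℓ) =
      ∫ z, ∫ w, f (Function.update z i w) ∂(Measure.pi fun _ => μ i) ∂(copyMeasure μ ℓ) := by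
  have h := measurePreserving_update (fun i => Measure.pi fun _ : Fin ℓ => μ i) i
  rw [← integral_prod _ (integrable_update μ i hf hint), copyMeasure]
  conv_lhs => rw [← h.map_eq]
  rw [integral_map h.measurable.aemeasurable hf.aestronglyMeasurable]

omit [Fintype ι] in
theorem measurable_prod_freeze {R : Type*} [CommMonoid R] [MeasurableSpace R] [MeasurableMul₂ R]
    (i : ι) {E : Fin ℓ → Copies X ℓ → R} (hE : ∀ k, Measurable (E k)) :
    Measurable fun z => ∏ k, E k (freeze i k z) :=
  Finset.measurable_fun_prod _ fun k _ => (hE k).comp (measurable_freeze i k)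

/-- The `k`-th factor sees only the `k`-th copy of `i`; these copies are independent, so the inner
integral factorises. -/
theorem lintegral_prod_freeze (i : ι) {E : Fin ℓ → Copies X ℓ → ℝ≥0∞}
    (hE : ∀ k, Measurable (E k)) :
    ∫⁻ z, ∏ k, E k (freeze i k z) ∂(copyMeasure μ ℓ) =
      ∫⁻ z, ∏ k, laverage μ i (E k) z ∂(copyMeasure μ ℓ) := by
  rw [lintegral_update μ i (measurable_prod_freeze i hE)]
  refine lintegral_congr fun z => ?_
  simp only [freeze_update]
  exact lintegral_prod_pi (fun _ : Fin ℓ => μ i)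
    (fun k x => E k (Function.update z i fun _ => x))
    (fun k => (hE k).comp ((measurable_update_const i).comp measurable_prodMk_left))

theorem integrable_prod_average (i : ι) {E : Fin ℓ → Copies X ℓ → ℝ} (hE : ∀ k, Measurable (E k))
    (hint : Integrable (fun z => ∏ k, E k (freeze i k z)) (copyMeasure μ ℓ)) :
    Integrable (fun z => ∏ k, average μ i (E k) z) (copyMeasure μ ℓ) := by
  have h := (integrable_update μ i (measurable_prod_freeze i hE) hint).integral_prod_left
  refine h.congr (Filter.Eventually.of_forall fun z => ?_)
  simp only [freeze_update]
  exact integral_fintype_prod_eq_prod (μ := fun _ : Fin ℓ => μ i)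
    (fun k x => E k (Function.update z i fun _ => x))

theorem integral_prod_freeze (i : ι) {E : Fin ℓ → Copies X ℓ → ℝ} (hE : ∀ k, Measurable (E k))
    (hint : Integrable (fun z => ∏ k, E k (freeze i k z)) (copyMeasure μ ℓ)) :
    ∫ z, ∏ k, E k (freeze i k z) ∂(copyMeasure μ ℓ) =
      ∫ z, ∏ k, average μ i (E k) z ∂(copyMeasure μ ℓ) := by
  rw [integral_update μ i (measurable_prod_freeze i hE) hint]
  refine integral_congr_ae (Filter.Eventually.of_forall fun z => ?_)
  simp only [freeze_update]
  exact integral_fintype_prod_eq_prod (μ := fun _ : Fin ℓ => μ i)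
    (fun k x => E k (Function.update z i fun _ => x))

variable [NeZero ℓ]

/-- `hAi` makes `A` constant in `i`, and `hBi` says that `B` sees only the `0`-th copy of `i`. The
integral over the copies of `i` therefore acts on `B` alone. -/
theorem lintegral_mul_laverage (i : ι) {A B : Copies X ℓ → ℝ≥0∞} (hA : Measurable A)
    (hB : Measurable B) (hAi : ∀ z w, A (Function.update z i w) = A z)
    (hBi : ∀ z, B (freeze i 0 z) = B z) :
    ∫⁻ z, A z * B z ∂(copyMeasure μ ℓ) = ∫⁻ z, A z * laverage μ i B z ∂(copyMeasure μ ℓ) := by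
  rw [lintegral_update μ i (f := fun z => A z * B z) (hA.mul hB)]
  refine lintegral_congr fun z => ?_
  simp only [hAi]
  have hu : ∀ w : Fin ℓ → X i, B (Function.update z i w) =
      B (Function.update z i fun _ => w 0) := fun w => by rw [← hBi, freeze_update]
  simp only [hu]
  have hm : Measurable fun x => B (Function.update z i fun _ => x) :=
    hB.comp ((measurable_update_const i).comp measurable_prodMk_left)
  have he := (measurePreserving_eval (μ := fun _ : Fin ℓ => μ i) 0).lintegral_comp hm
  rw [lintegral_const_mul _ (f := fun w : Fin ℓ → X i => B (Function.update z i fun _ => w 0))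
    (hm.comp (measurable_pi_apply 0)), laverage, ← he]

theorem integral_mul_average (i : ι) {A B : Copies X ℓ → ℝ} (hA : Measurable A)
    (hB : Measurable B) (hAi : ∀ z w, A (Function.update z i w) = A z)
    (hBi : ∀ z, B (freeze i 0 z) = B z)
    (hint : Integrable (fun z => A z * B z) (copyMeasure μ ℓ)) :
    ∫ z, A z * B z ∂(copyMeasure μ ℓ) = ∫ z, A z * average μ i B z ∂(copyMeasure μ ℓ) := by
  rw [integral_update μ i (f := fun z => A z * B z) (hA.mul hB) hint]
  refine integral_congr_ae (Filter.Eventually.of_forall fun z => ?_)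
  simp only [hAi]
  have hu : ∀ w : Fin ℓ → X i, B (Function.update z i w) =
      B (Function.update z i fun _ => w 0) := fun w => by rw [← hBi, freeze_update]
  simp only [hu]
  have hm : Measurable fun x => B (Function.update z i fun _ => x) :=
    hB.comp ((measurable_update_const i).comp measurable_prodMk_left)
  have he := measurePreserving_eval (μ := fun _ : Fin ℓ => μ i) 0
  rw [integral_const_mul, average]
  conv_rhs => rw [← he.map_eq]
  rw [integral_map he.measurable.aemeasurable hm.aestronglyMeasurable]

end Measure

/-! ### Hölder's inequality with repeated duplication of coordinates. -/

section Holder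

variable {ι : Type*} [Fintype ι] [DecidableEq ι] {X : ι → Type*} [∀ i, MeasurableSpace (X i)]
  {ℓ : ℕ} [NeZero ℓ] (μ : (i : ι) → Measure (X i)) [∀ i, IsProbabilityMeasure (μ i)]

theorem pow_rpow_inv_copies (x : ℝ≥0∞) : (x ^ ℓ) ^ ((ℓ : ℝ)⁻¹) = x :=
  ENNReal.pow_rpow_inv_natCast (NeZero.ne ℓ) x

theorem lintegral_prod_le_prod_lintegral_pow {α : Type*} [MeasurableSpace α] (m : Measure α)
    {f : Fin ℓ → α → ℝ≥0∞} (hf : ∀ k, Measurable (f k)) :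
    ∫⁻ z, ∏ k, f k z ∂m ≤ ∏ k, (∫⁻ z, f k z ^ ℓ ∂m) ^ ((ℓ : ℝ)⁻¹) := by
  have h := ENNReal.lintegral_prod_norm_pow_le (μ := m) (Finset.univ : Finset (Fin ℓ))
    (f := fun k z => f k z ^ ℓ) (fun k _ => ((hf k).pow_const ℓ).aemeasurable)
    (p := fun _ => (ℓ : ℝ)⁻¹) (by simp [NeZero.ne ℓ]) (fun _ _ => by positivity)
  simpa only [pow_rpow_inv_copies] using h

omit [NeZero ℓ] in
theorem lintegral_laverage_pow (i : ι) {E : Copies X ℓ → ℝ≥0∞} (hE : Measurable E) :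
    ∫⁻ z, laverage μ i E z ^ ℓ ∂(copyMeasure μ ℓ) =
      ∫⁻ z, ∏ k, E (freeze i k z) ∂(copyMeasure μ ℓ) := by
  rw [lintegral_prod_freeze μ i (E := fun _ => E) fun _ => hE]
  simp

theorem lintegral_prod_freeze_le (i : ι) {E : Fin ℓ → Copies X ℓ → ℝ≥0∞}
    (hE : ∀ k, Measurable (E k)) :
    ∫⁻ z, ∏ k, E k (freeze i k z) ∂(copyMeasure μ ℓ) ≤
      ∏ k, (∫⁻ z, ∏ k', E k (freeze i k' z) ∂(copyMeasure μ ℓ)) ^ ((ℓ : ℝ)⁻¹) := by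
  rw [lintegral_prod_freeze μ i hE]
  refine (lintegral_prod_le_prod_lintegral_pow _ fun k => measurable_laverage μ i (hE k)).trans ?_
  simp only [lintegral_laverage_pow μ i (hE _), le_refl]

omit [NeZero ℓ] in
theorem integrable_average_pow (i : ι) {E : Copies X ℓ → ℝ} (hE : Measurable E)
    (hint : Integrable (fun z => ∏ k, E (freeze i k z)) (copyMeasure μ ℓ)) :
    Integrable (fun z => average μ i E z ^ ℓ) (copyMeasure μ ℓ) := by
  simpa using integrable_prod_average μ i (E := fun _ => E) (fun _ => hE) hint

omit [NeZero ℓ] in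
theorem integral_average_pow (i : ι) {E : Copies X ℓ → ℝ} (hE : Measurable E)
    (hint : Integrable (fun z => ∏ k, E (freeze i k z)) (copyMeasure μ ℓ)) :
    ∫ z, ∏ k, E (freeze i k z) ∂(copyMeasure μ ℓ) =
      ∫ z, average μ i E z ^ ℓ ∂(copyMeasure μ ℓ) := by
  simpa using integral_prod_freeze μ i (E := fun _ => E) (fun _ => hE) hint

omit [NeZero ℓ] in
theorem integral_prod_freeze_nonneg (heven : Even ℓ) (i : ι) {E : Copies X ℓ → ℝ}
    (hE : Measurable E) (hint : Integrable (fun z => ∏ k, E (freeze i k z)) (copyMeasure μ ℓ)) :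
    0 ≤ ∫ z, ∏ k, E (freeze i k z) ∂(copyMeasure μ ℓ) := by
  rw [integral_average_pow μ i hE hint]
  exact integral_nonneg fun z => heven.pow_nonneg _

theorem enorm_eq_lintegral_enorm_of_nonneg {α : Type*} [MeasurableSpace α] {m : Measure α}
    {f : α → ℝ} (hf : Integrable f m) (h0 : ∀ x, 0 ≤ f x) :
    ‖∫ x, f x ∂m‖ₑ = ∫⁻ x, ‖f x‖ₑ ∂m := by
  rw [Real.enorm_of_nonneg (integral_nonneg h0),
    ofReal_integral_eq_lintegral_ofReal hf (Filter.Eventually.of_forall h0)]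
  simp only [Real.enorm_of_nonneg (h0 _)]

omit [NeZero ℓ] in
-- Evenness is essential: the ℓ-th power of the signed average equals that of its absolute value, so
-- its integral is a signed box integral.
theorem lintegral_enorm_average_pow (heven : Even ℓ) (i : ι) {E : Copies X ℓ → ℝ}
    (hE : Measurable E) (hint : Integrable (fun z => ∏ k, E (freeze i k z)) (copyMeasure μ ℓ)) :
    ∫⁻ z, ‖average μ i E z‖ₑ ^ ℓ ∂(copyMeasure μ ℓ) =
      ‖∫ z, ∏ k, E (freeze i k z) ∂(copyMeasure μ ℓ)‖ₑ := by
  rw [integral_average_pow μ i hE hint, enorm_eq_lintegral_enorm_of_nonneg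
    (integrable_average_pow μ i hE hint) fun z => heven.pow_nonneg _]
  simp only [enorm_pow]

theorem enorm_prod_real {α : Type*} (s : Finset α) (f : α → ℝ) :
    ‖∏ a ∈ s, f a‖ₑ = ∏ a ∈ s, ‖f a‖ₑ := by
  induction s using Finset.cons_induction with
  | empty => simp
  | cons a s ha ih => rw [Finset.prod_cons, Finset.prod_cons, enorm_mul, ih]

theorem enorm_integral_prod_freeze_le (heven : Even ℓ) (i : ι) {E : Fin ℓ → Copies X ℓ → ℝ}
    (hE : ∀ k, Measurable (E k))
    (hint : Integrable (fun z => ∏ k, E k (freeze i k z)) (copyMeasure μ ℓ))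
    (hint' : ∀ k, Integrable (fun z => ∏ k', E k (freeze i k' z)) (copyMeasure μ ℓ)) :
    ‖∫ z, ∏ k, E k (freeze i k z) ∂(copyMeasure μ ℓ)‖ₑ ≤
      ∏ k, ‖∫ z, ∏ k', E k (freeze i k' z) ∂(copyMeasure μ ℓ)‖ₑ ^ ((ℓ : ℝ)⁻¹) := by
  rw [integral_prod_freeze μ i hE hint]
  refine (enorm_integral_le_lintegral_enorm _).trans ?_
  simp only [enorm_prod_real]
  refine (lintegral_prod_le_prod_lintegral_pow _
    fun k => (measurable_average μ i (hE k)).enorm).trans ?_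
  simp only [lintegral_enorm_average_pow μ heven i (hE _) (hint' _), le_refl]

theorem lintegral_mul_le_freeze {s : ℝ} (hs : s.HolderConjugate ℓ) (i : ι)
    {A B : Copies X ℓ → ℝ≥0∞} (hA : Measurable A)
    (hB : Measurable B) (hAi : ∀ z w, A (Function.update z i w) = A z)
    (hBi : ∀ z, B (freeze i 0 z) = B z) :
    ∫⁻ z, A z * B z ∂(copyMeasure μ ℓ) ≤ (∫⁻ z, A z ^ s ∂(copyMeasure μ ℓ)) ^ s⁻¹ *
      (∫⁻ z, ∏ k, B (freeze i k z) ∂(copyMeasure μ ℓ)) ^ (ℓ : ℝ)⁻¹ := by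
  rw [lintegral_mul_laverage μ i hA hB hAi hBi]
  have h := ENNReal.lintegral_mul_le_Lp_mul_Lq (copyMeasure μ ℓ) hs hA.aemeasurable
    (measurable_laverage μ i hB).aemeasurable
  simpa only [Pi.mul_apply, ENNReal.rpow_natCast, lintegral_laverage_pow μ i hB, one_div] using h

/-- The basic step: average `B` over `i`, apply Hölder with exponents `s` and `ℓ`, and unfold the
ℓ-th power of the average of `B`. -/
theorem enorm_integral_mul_le_freeze (heven : Even ℓ) {s : ℝ} (hs : s.HolderConjugate ℓ) (i : ι)
    {A B : Copies X ℓ → ℝ} (hA : Measurable A)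
    (hB : Measurable B) (hAi : ∀ z w, A (Function.update z i w) = A z)
    (hBi : ∀ z, B (freeze i 0 z) = B z)
    (hint : Integrable (fun z => A z * B z) (copyMeasure μ ℓ))
    (hint' : Integrable (fun z => ∏ k, B (freeze i k z)) (copyMeasure μ ℓ)) :
    ‖∫ z, A z * B z ∂(copyMeasure μ ℓ)‖ₑ ≤ (∫⁻ z, ‖A z‖ₑ ^ s ∂(copyMeasure μ ℓ)) ^ s⁻¹ *
      ‖∫ z, ∏ k, B (freeze i k z) ∂(copyMeasure μ ℓ)‖ₑ ^ (ℓ : ℝ)⁻¹ := by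
  rw [integral_mul_average μ i hA hB hAi hBi hint]
  refine (enorm_integral_le_lintegral_enorm _).trans ?_
  simp only [enorm_mul]
  have h := ENNReal.lintegral_mul_le_Lp_mul_Lq (copyMeasure μ ℓ) hs hA.enorm.aemeasurable
    (measurable_average μ i hB).enorm.aemeasurable
  simpa only [Pi.mul_apply, ENNReal.rpow_natCast, lintegral_enorm_average_pow μ heven i hB hint',
    one_div] using h

omit [Fintype ι] in
-- Unwinding the one-step inequality. A factor `b i` that enters at stage `R'` has exponent `ℓ ^
-- |R'|` and then passes through `|R'| - |R|` roots of order `ℓ`. It ends with exponent `ℓ ^ |R|`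
-- whatever the order of insertion.
theorem le_of_forall_le_insert {S : Finset ι} (T : Finset ι → ℝ≥0∞) (b : ι → ℝ≥0∞)
    (h : ∀ R ⊆ S, ∀ i ∈ S, i ∉ R → T R ≤ b i ^ (ℓ ^ R.card) * T (insert i R) ^ (ℓ : ℝ)⁻¹)
    {R : Finset ι} (hR : R ⊆ S) :
    T R ≤ T S ^ ((ℓ : ℝ) ^ (S \ R).card)⁻¹ * ∏ i ∈ S \ R, b i ^ (ℓ ^ R.card) := by
  induction hm : (S \ R).card generalizing R with
  | zero =>
    rw [Finset.card_eq_zero, Finset.sdiff_eq_empty_iff_subset] at hm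
    obtain rfl := hm.antisymm hR
    simp
  | succ m ih =>
    obtain ⟨i, hi⟩ : (S \ R).Nonempty := by rw [← Finset.card_pos]; omega
    have hi' := Finset.mem_sdiff.1 hi
    have hsd : S \ insert i R = (S \ R).erase i := by
      ext j; simp only [Finset.mem_sdiff, Finset.mem_insert, Finset.mem_erase]; tauto
    have hc : (S \ insert i R).card = m := by rw [hsd, Finset.card_erase_of_mem hi]; omega
    have ih' := ih (R := insert i R) (Finset.insert_subset hi'.1 hR) hc
    refine (h R hR i hi'.1 hi'.2).trans ?_
    rw [← Finset.mul_prod_erase _ _ hi, ← hsd, Finset.card_insert_of_notMem hi'.2] at *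
    calc b i ^ ℓ ^ R.card * T (insert i R) ^ (ℓ : ℝ)⁻¹
        ≤ b i ^ ℓ ^ R.card * (T S ^ ((ℓ : ℝ) ^ m)⁻¹ *
            ∏ j ∈ S \ insert i R, b j ^ (ℓ ^ (R.card + 1))) ^ (ℓ : ℝ)⁻¹ := by
          gcongr
      _ = _ := by
          rw [ENNReal.mul_rpow_of_nonneg _ _ (by positivity), ← ENNReal.rpow_mul,
            ← ENNReal.prod_rpow_of_nonneg (by positivity)]
          simp only [pow_succ ℓ R.card, pow_mul, pow_rpow_inv_copies]
          rw [pow_succ (ℓ : ℝ) m, mul_inv]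
          ring

/-- Monotonicity of normalised box integrals in the set of duplicated coordinates: the Hölder step
with trivial factor `A = 1`. -/
theorem lintegral_dup_le {R R' : Finset ι} (hR : R ⊆ R') (hℓ : 1 < ℓ) {G : Copies X ℓ → ℝ≥0∞}
    (hG : Measurable G) (hG0 : ∀ i ∈ R', ∀ z, G (freeze i 0 z) = G z) :
    ∫⁻ z, dup R G z ∂(copyMeasure μ ℓ) ≤
      (∫⁻ z, dup R' G z ∂(copyMeasure μ ℓ)) ^ ((ℓ : ℝ) ^ (R' \ R).card)⁻¹ := by
  have h := le_of_forall_le_insert (ℓ := ℓ) (S := R')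
    (fun R => ∫⁻ z, dup R G z ∂(copyMeasure μ ℓ)) (fun _ => 1) ?_ hR
  · simpa using h
  intro R hR i hi hiR
  have hc : (ℓ : ℝ).conjExponent.HolderConjugate ℓ :=
    (Real.HolderConjugate.conjExponent (by exact_mod_cast hℓ)).symm
  have h := lintegral_mul_le_freeze μ hc i (A := fun _ => 1) (B := dup R G) measurable_const
    (measurable_dup R hG) (fun _ _ => rfl)
    (fun z => by rw [dup_freeze_of_notMem hiR]; simp only [hG0 i hi])
  simpa [dup_insert hiR] using h

variable {S : Finset ι} {Φ : Copies X ℓ → ℝ} {h : ι → Copies X ℓ → ℝ} {s : ℝ} {b : ι → ℝ≥0∞}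

omit [(i : ι) → MeasurableSpace (X i)] in
theorem dup_mul_prod_sdiff {R : Finset ι} {i : ι} (hi : i ∈ S) (hiR : i ∉ R) (z : Copies X ℓ) :
    dup R (fun z => Φ z * ∏ j ∈ S \ R, h j z) z =
      dup R (h i) z * dup R (fun z => Φ z * ∏ j ∈ S \ insert i R, h j z) z := by
  have hsd : S \ insert i R = (S \ R).erase i := by
    ext j; simp only [Finset.mem_sdiff, Finset.mem_insert, Finset.mem_erase]; tauto
  rw [← dup_mul, hsd]
  congr 1
  funext z
  rw [← Finset.mul_prod_erase _ (fun j => h j z) (Finset.mem_sdiff.2 ⟨hi, hiR⟩)]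
  ring

/-- The iteration with absolute values. It loses the cancellation in `Φ`, but it yields the
integrability at every stage that the signed iteration needs for Fubini. -/
theorem lintegral_dup_mul_prod_le (hs : s.HolderConjugate ℓ) (hΦ : Measurable Φ)
    (hh : ∀ i ∈ S, Measurable (h i))
    (hΦ0 : ∀ i ∈ S, ∀ z, Φ (freeze i 0 z) = Φ z)
    (hh0 : ∀ i ∈ S, ∀ j ∈ S, ∀ z, h i (freeze j 0 z) = h i z)
    (hhi : ∀ i ∈ S, ∀ z w, h i (Function.update z i w) = h i z)
    (hb : ∀ i ∈ S, ∀ R ⊆ S.erase i,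
      (∫⁻ z, dup R (fun z => ‖h i z‖ₑ ^ s) z ∂(copyMeasure μ ℓ)) ^ s⁻¹ ≤ b i ^ ℓ ^ R.card)
    {R : Finset ι} (hR : R ⊆ S) :
    ∫⁻ z, ‖dup R (fun z => Φ z * ∏ i ∈ S \ R, h i z) z‖ₑ ∂(copyMeasure μ ℓ) ≤
      (∫⁻ z, ‖dup S Φ z‖ₑ ∂(copyMeasure μ ℓ)) ^ ((ℓ : ℝ) ^ (S \ R).card)⁻¹ *
        ∏ i ∈ S \ R, b i ^ ℓ ^ R.card := by
  have key := le_of_forall_le_insert (ℓ := ℓ) (S := S) (fun R =>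
    ∫⁻ z, ‖dup R (fun z => Φ z * ∏ i ∈ S \ R, h i z) z‖ₑ ∂(copyMeasure μ ℓ)) b ?_ hR
  · simpa using key
  intro R hR i hi hiR
  have hmB : Measurable (fun z => Φ z * ∏ j ∈ S \ insert i R, h j z) :=
    hΦ.mul (Finset.measurable_fun_prod _ fun j hj => hh j (Finset.mem_sdiff.1 hj).1)
  have hB0 : ∀ z, Φ (freeze i 0 z) * ∏ j ∈ S \ insert i R, h j (freeze i 0 z) =
      Φ z * ∏ j ∈ S \ insert i R, h j z := fun z => by
    rw [hΦ0 i hi]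
    congr 1
    exact Finset.prod_congr rfl fun j hj => hh0 j (Finset.mem_sdiff.1 hj).1 i hi z
  have h1 := lintegral_mul_le_freeze μ hs i (A := fun z => ‖dup R (h i) z‖ₑ)
    (B := fun z => ‖dup R (fun z => Φ z * ∏ j ∈ S \ insert i R, h j z) z‖ₑ)
    (measurable_dup R (hh i hi)).enorm (measurable_dup R hmB).enorm
    (fun z w => by rw [dup_update_of_notMem hiR]; simp only [hhi i hi])
    (fun z => by rw [dup_freeze_of_notMem hiR]; simp only [hB0])
  have hsplit : ∀ z, ‖dup R (fun z => Φ z * ∏ j ∈ S \ R, h j z) z‖ₑ = ‖dup R (h i) z‖ₑ *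
      ‖dup R (fun z => Φ z * ∏ j ∈ S \ insert i R, h j z) z‖ₑ := fun z => by
    rw [dup_mul_prod_sdiff hi hiR, enorm_mul]
  simp only [hsplit]
  refine h1.trans ?_
  gcongr
  · refine le_trans (le_of_eq ?_) (hb i hi R (Finset.subset_erase.2 ⟨hR, hiR⟩))
    simp only [enorm_dup, dup_rpow _ _ hs.nonneg]
  · refine le_of_eq ?_
    rw [dup_insert hiR, enorm_prod_real]

theorem integrable_dup_mul_prod (hs : s.HolderConjugate ℓ) (hΦ : Measurable Φ)
    (hh : ∀ i ∈ S, Measurable (h i))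
    (hΦ0 : ∀ i ∈ S, ∀ z, Φ (freeze i 0 z) = Φ z)
    (hh0 : ∀ i ∈ S, ∀ j ∈ S, ∀ z, h i (freeze j 0 z) = h i z)
    (hhi : ∀ i ∈ S, ∀ z w, h i (Function.update z i w) = h i z)
    (hb : ∀ i ∈ S, ∀ R ⊆ S.erase i,
      (∫⁻ z, dup R (fun z => ‖h i z‖ₑ ^ s) z ∂(copyMeasure μ ℓ)) ^ s⁻¹ ≤ b i ^ ℓ ^ R.card)
    (hb' : ∀ i ∈ S, b i < ⊤) (hint : Integrable (dup S Φ) (copyMeasure μ ℓ))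
    {R : Finset ι} (hR : R ⊆ S) :
    Integrable (dup R (fun z => Φ z * ∏ i ∈ S \ R, h i z)) (copyMeasure μ ℓ) := by
  refine ⟨(measurable_dup R (hΦ.mul (Finset.measurable_fun_prod _
    fun j hj => hh j (Finset.mem_sdiff.1 hj).1))).aestronglyMeasurable, ?_⟩
  refine (lintegral_dup_mul_prod_le μ hs hΦ hh hΦ0 hh0 hhi hb hR).trans_lt ?_
  refine ENNReal.mul_lt_top (ENNReal.rpow_lt_top_of_nonneg (by positivity) hint.2.ne) ?_
  exact ENNReal.prod_lt_top fun i hi => ENNReal.pow_lt_top (hb' i (Finset.mem_sdiff.1 hi).1)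

/-- The signed iteration: stage `R` has the coordinates of `R` duplicated and the factors `h i` with
`i ∈ R` removed, so the last stage is the signed integral of `dup S Φ`. -/
theorem enorm_integral_mul_prod_le (heven : Even ℓ) (hs : s.HolderConjugate ℓ) (hΦ : Measurable Φ)
    (hh : ∀ i ∈ S, Measurable (h i))
    (hΦ0 : ∀ i ∈ S, ∀ z, Φ (freeze i 0 z) = Φ z)
    (hh0 : ∀ i ∈ S, ∀ j ∈ S, ∀ z, h i (freeze j 0 z) = h i z)
    (hhi : ∀ i ∈ S, ∀ z w, h i (Function.update z i w) = h i z)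
    (hb : ∀ i ∈ S, ∀ R ⊆ S.erase i,
      (∫⁻ z, dup R (fun z => ‖h i z‖ₑ ^ s) z ∂(copyMeasure μ ℓ)) ^ s⁻¹ ≤ b i ^ ℓ ^ R.card)
    (hb' : ∀ i ∈ S, b i < ⊤) (hint : Integrable (dup S Φ) (copyMeasure μ ℓ)) :
    Integrable (fun z => Φ z * ∏ i ∈ S, h i z) (copyMeasure μ ℓ) ∧
    ‖∫ z, Φ z * ∏ i ∈ S, h i z ∂(copyMeasure μ ℓ)‖ₑ ≤
      ‖∫ z, dup S Φ z ∂(copyMeasure μ ℓ)‖ₑ ^ ((ℓ : ℝ) ^ S.card)⁻¹ * ∏ i ∈ S, b i := by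
  have hI := fun {R : Finset ι} (hR : R ⊆ S) =>
    integrable_dup_mul_prod μ hs hΦ hh hΦ0 hh0 hhi hb hb' hint hR
  have key := le_of_forall_le_insert (ℓ := ℓ) (S := S) (fun R =>
    ‖∫ z, dup R (fun z => Φ z * ∏ i ∈ S \ R, h i z) z ∂(copyMeasure μ ℓ)‖ₑ) b ?_
    (Finset.empty_subset S)
  · exact ⟨by simpa [dup_empty] using hI (Finset.empty_subset S),
      by simpa [dup_empty] using key⟩
  intro R hR i hi hiR
  have hmB : Measurable (fun z => Φ z * ∏ j ∈ S \ insert i R, h j z) :=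
    hΦ.mul (Finset.measurable_fun_prod _ fun j hj => hh j (Finset.mem_sdiff.1 hj).1)
  have hB0 : ∀ z, Φ (freeze i 0 z) * ∏ j ∈ S \ insert i R, h j (freeze i 0 z) =
      Φ z * ∏ j ∈ S \ insert i R, h j z := fun z => by
    rw [hΦ0 i hi]
    congr 1
    exact Finset.prod_congr rfl fun j hj => hh0 j (Finset.mem_sdiff.1 hj).1 i hi z
  have hsplit := dup_mul_prod_sdiff (Φ := Φ) (h := h) hi hiR
  have hins := fun z => dup_insert hiR (fun z => Φ z * ∏ j ∈ S \ insert i R, h j z) z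
  have h1 := enorm_integral_mul_le_freeze μ heven hs i (A := dup R (h i))
    (B := dup R (fun z => Φ z * ∏ j ∈ S \ insert i R, h j z))
    (measurable_dup R (hh i hi)) (measurable_dup R hmB)
    (fun z w => by rw [dup_update_of_notMem hiR]; simp only [hhi i hi])
    (fun z => by rw [dup_freeze_of_notMem hiR]; simp only [hB0])
    (by simpa only [← hsplit] using hI hR)
    (by simpa only [← hins] using hI (Finset.insert_subset hi hR))
  simp only [hsplit]
  refine h1.trans ?_
  gcongr
  · refine le_trans (le_of_eq ?_) (hb i hi R (Finset.subset_erase.2 ⟨hR, hiR⟩))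
    simp only [enorm_dup, dup_rpow _ _ hs.nonneg]
  · refine le_of_eq ?_
    simp only [hins]

end Holder

/-! ### The generalised von Neumann inequality. -/

section VonNeumann

variable {ι : Type*} [DecidableEq ι] {X : ι → Type*} {ℓ : ℕ} [NeZero ℓ]

/-- The point formed by the `0`-th copies of all the coordinates. -/
def origin (z : Copies X ℓ) : (i : ι) → X i := fun i => z i 0

theorem origin_freeze_zero (i : ι) (z : Copies X ℓ) : origin (freeze i 0 z) = origin z := by
  funext j
  by_cases h : j = i
  · subst h; simp [origin, freeze]
  · simp [origin, freeze, h]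

omit [NeZero ℓ] in
theorem freeze_comm {i j : ι} (h : i ≠ j) (k k' : Fin ℓ) (z : Copies X ℓ) :
    freeze i k (freeze j k' z) = freeze j k' (freeze i k z) := by
  simp [freeze, Function.update_comm h, Function.update_of_ne h, Function.update_of_ne h.symm]

theorem origin_freeze_freeze_zero {i j : ι} (h : i ≠ j) (k : Fin ℓ) (z : Copies X ℓ) :
    origin (freeze j k (freeze i 0 z)) = origin (freeze j k z) := by
  rw [freeze_comm h.symm, origin_freeze_zero]

theorem origin_update (i : ι) (z : Copies X ℓ) (w : Fin ℓ → X i) :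
    origin (Function.update z i w) = Function.update (origin z) i (w 0) := by
  funext j
  by_cases h : j = i
  · subst h; simp [origin]
  · simp [origin, h]

variable [Fintype ι] [∀ i, MeasurableSpace (X i)]

omit [DecidableEq ι] [Fintype ι] in
theorem measurable_origin : Measurable (origin : Copies X ℓ → (i : ι) → X i) := by
  unfold origin; fun_prop

variable (μ : (i : ι) → Measure (X i)) [∀ i, IsProbabilityMeasure (μ i)] {s : ℝ}
  {e S : Finset ι} {j : ι} {K : ℝ≥0∞}

theorem lintegral_dup_prod_freeze_le (hj : j ∉ S) {G : Fin ℓ → Copies X ℓ → ℝ≥0∞}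
    (hG : ∀ k, Measurable (G k)) :
    ∫⁻ z, dup S (fun z => ∏ k, G k (freeze j k z)) z ∂(copyMeasure μ ℓ) ≤
      ∏ k, (∫⁻ z, dup (insert j S) (G k) z ∂(copyMeasure μ ℓ)) ^ (ℓ : ℝ)⁻¹ := by
  have h := lintegral_prod_freeze_le μ j (E := fun k => dup S (G k))
    fun k => measurable_dup S (hG k)
  simpa only [dup_insert hj, dup_prod, dup_freeze_of_notMem hj] using h

/-- The bound on the split-off factors, with `b i = K ^ ℓ`. Enlarge `R` to `e.erase i`, then
separate the copies of `j` by Hölder to reach box integrals over the edge missing `i`. The roots of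
orders `ℓ ^ (|e| - 1 - |R|)` and `s` turn `K ^ (s ℓ^|e|)` into `K ^ (ℓ^(|R|+1))`. -/
theorem lintegral_dup_rpow_prod_freeze_le (hℓ : 1 < ℓ) (hs : s.HolderConjugate ℓ) (hj : j ∉ e)
    {i : ι} (hi : i ∈ e) {g : Fin ℓ → ((i : ι) → X i) → ℝ} (hg : ∀ k, Measurable (g k))
    (hbox : ∀ k, ∫⁻ z, dup (insert j (e.erase i)) (fun z => ‖g k (origin z)‖ₑ ^ s) z
      ∂(copyMeasure μ ℓ) ≤ K ^ (s * (ℓ : ℝ) ^ e.card)) {R : Finset ι} (hR : R ⊆ e.erase i) :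
    (∫⁻ z, dup R (fun z => ‖∏ k, g k (origin (freeze j k z))‖ₑ ^ s) z
      ∂(copyMeasure μ ℓ)) ^ s⁻¹ ≤ (K ^ ℓ) ^ ℓ ^ R.card := by
  have hs0 := hs.pos
  have hj' : j ∉ e.erase i := fun h => hj (Finset.mem_of_mem_erase h)
  have hℓ0 : (ℓ : ℝ) ≠ 0 := by exact_mod_cast NeZero.ne ℓ
  have hG : ∀ k, Measurable fun z : Copies X ℓ => ‖g k (origin z)‖ₑ ^ s := fun k =>
    (((hg k).comp measurable_origin).enorm).pow_const s
  have hprod : ∀ z : Copies X ℓ, ‖∏ k, g k (origin (freeze j k z))‖ₑ ^ s =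
      ∏ k, ‖g k (origin (freeze j k z))‖ₑ ^ s := fun z => by
    rw [enorm_prod_real, ENNReal.prod_rpow_of_nonneg hs0.le]
  simp only [hprod]
  have h1 := lintegral_dup_le μ hR hℓ
    (G := fun z => ∏ k, ‖g k (origin (freeze j k z))‖ₑ ^ s)
    (measurable_prod_freeze j (E := fun k z => ‖g k (origin z)‖ₑ ^ s) hG)
    (fun i' hi' z => by
      have : i' ≠ j := fun h => hj' (h ▸ hi')
      simp only [origin_freeze_freeze_zero this])
  have h2 : ∫⁻ z, dup (e.erase i) (fun z => ∏ k, ‖g k (origin (freeze j k z))‖ₑ ^ s) z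
      ∂(copyMeasure μ ℓ) ≤ K ^ (s * (ℓ : ℝ) ^ e.card) := by
    refine (lintegral_dup_prod_freeze_le μ hj' hG).trans ?_
    calc _ ≤ ∏ _k : Fin ℓ, (K ^ (s * (ℓ : ℝ) ^ e.card)) ^ (ℓ : ℝ)⁻¹ := by
          gcongr with k _
          exact hbox k
      _ = _ := by
          rw [Finset.prod_const, Finset.card_univ, Fintype.card_fin,
            ENNReal.rpow_inv_natCast_pow (NeZero.ne ℓ)]
  calc _ ≤ ((K ^ (s * (ℓ : ℝ) ^ e.card)) ^ ((ℓ : ℝ) ^ (e.erase i \ R).card)⁻¹) ^ s⁻¹ := by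
        gcongr
        exact h1.trans (by gcongr)
    _ = _ := by
        rw [← ENNReal.rpow_mul, ← ENNReal.rpow_mul, ← pow_mul, ← ENNReal.rpow_natCast]
        congr 1
        have hc : e.card = (e.erase i \ R).card + R.card + 1 := by
          rw [Finset.card_sdiff_add_card_eq_card hR, Finset.card_erase_add_one hi]
        rw [hc]
        push_cast
        rw [pow_succ, pow_add]
        field_simp

variable {Φ : Copies X ℓ → ℝ} {g : ι → Fin ℓ → ((i : ι) → X i) → ℝ}

theorem integrable_and_enorm_integral_mul_prod_prod_le (heven : Even ℓ) (hℓ : 1 < ℓ)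
    (hs : s.HolderConjugate ℓ) (hj : j ∉ e) (hS : S ⊆ e) (hΦ : Measurable Φ)
    (hΦ0 : ∀ i ∈ S, ∀ z, Φ (freeze i 0 z) = Φ z) (hg : ∀ i ∈ S, ∀ k, Measurable (g i k))
    (hgi : ∀ i ∈ S, ∀ k x a, g i k (Function.update x i a) = g i k x) (hK : K < ⊤)
    (hbox : ∀ i ∈ S, ∀ k, ∫⁻ z, dup (insert j (e.erase i)) (fun z => ‖g i k (origin z)‖ₑ ^ s) z
      ∂(copyMeasure μ ℓ) ≤ K ^ (s * (ℓ : ℝ) ^ e.card))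
    (hint : Integrable (dup S Φ) (copyMeasure μ ℓ)) :
    Integrable (fun z => Φ z * ∏ i ∈ S, ∏ k, g i k (origin (freeze j k z))) (copyMeasure μ ℓ) ∧
    ‖∫ z, Φ z * ∏ i ∈ S, ∏ k, g i k (origin (freeze j k z)) ∂(copyMeasure μ ℓ)‖ₑ ≤
      ‖∫ z, dup S Φ z ∂(copyMeasure μ ℓ)‖ₑ ^ ((ℓ : ℝ) ^ S.card)⁻¹ * K ^ (ℓ * S.card) := by
  have hne : ∀ i ∈ S, i ≠ j := fun i hi h => hj (h ▸ hS hi)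
  have h := enorm_integral_mul_prod_le μ heven hs (S := S) (Φ := Φ)
    (h := fun i z => ∏ k, g i k (origin (freeze j k z))) (b := fun _ => K ^ ℓ) hΦ
    (fun i hi => measurable_prod_freeze j (E := fun k z => g i k (origin z))
      fun k => (hg i hi k).comp measurable_origin)
    hΦ0
    (fun i hi i' hi' z => by simp only [origin_freeze_freeze_zero (hne i' hi')])
    (fun i hi z w => by
      simp only [update_freeze_of_ne (hne i hi).symm, origin_update, hgi i hi])
    (fun i hi R hR => lintegral_dup_rpow_prod_freeze_le μ hℓ hs hj (hS hi) (hg i hi) (hbox i hi)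
      (hR.trans (Finset.erase_subset_erase i hS)))
    (fun _ _ => ENNReal.pow_lt_top hK) hint
  simpa only [Finset.prod_const, ← pow_mul] using h

/-- The case of a distinguished factor on the edge `e` itself: all of `e` is duplicated and the
copies of `j` disappear with the `g i k`. -/
theorem dup_origin_integral_le {F : ((i : ι) → X i) → ℝ} (heven : Even ℓ) (hℓ : 1 < ℓ)
    (hs : s.HolderConjugate ℓ) (hj : j ∉ e) (hF : Measurable F)
    (hg : ∀ i ∈ e, ∀ k, Measurable (g i k))
    (hgi : ∀ i ∈ e, ∀ k x a, g i k (Function.update x i a) = g i k x) (hK : K < ⊤)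
    (hbox : ∀ i ∈ e, ∀ k, ∫⁻ z, dup (insert j (e.erase i)) (fun z => ‖g i k (origin z)‖ₑ ^ s) z
      ∂(copyMeasure μ ℓ) ≤ K ^ (s * (ℓ : ℝ) ^ e.card))
    (hint : Integrable (dup e fun z => F (origin z)) (copyMeasure μ ℓ)) {a : ℝ≥0∞}
    (ha : ‖∫ z, dup e (fun z => F (origin z)) z ∂(copyMeasure μ ℓ)‖ₑ ≤ a ^ ℓ ^ e.card) :
    Integrable (fun z => F (origin z) * ∏ i ∈ e, ∏ k, g i k (origin (freeze j k z)))
      (copyMeasure μ ℓ) ∧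
    ‖∫ z, F (origin z) * ∏ i ∈ e, ∏ k, g i k (origin (freeze j k z)) ∂(copyMeasure μ ℓ)‖ₑ ≤
      a * K ^ (ℓ * e.card) := by
  obtain ⟨h1, h2⟩ := integrable_and_enorm_integral_mul_prod_prod_le μ heven hℓ hs hj
    (Finset.Subset.refl e) (hF.comp measurable_origin)
    (fun i _ z => by simp only [Function.comp, origin_freeze_zero]) hg hgi hK hbox hint
  refine ⟨h1, h2.trans ?_⟩
  gcongr
  calc _ ≤ (a ^ ℓ ^ e.card) ^ ((ℓ : ℝ) ^ e.card)⁻¹ := by gcongr; exact ha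
    _ = a := by
      exact_mod_cast ENNReal.pow_rpow_inv_natCast (pow_ne_zero _ (NeZero.ne ℓ)) a

/-- The case of a distinguished factor on the edge that misses `i₀` and contains `j`. Its versions
at all copies of `j` stay together while `e.erase i₀` is duplicated; a last Hölder over the copies
of `j` separates them into box integrals. -/
theorem dup_prod_freeze_integral_le {F : Fin ℓ → ((i : ι) → X i) → ℝ} (heven : Even ℓ) (hℓ : 1 < ℓ)
    (hs : s.HolderConjugate ℓ) (hj : j ∉ e) {i₀ : ι} (hi₀ : i₀ ∈ e) (hF : ∀ k, Measurable (F k))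
    (hg : ∀ i ∈ e.erase i₀, ∀ k, Measurable (g i k))
    (hgi : ∀ i ∈ e.erase i₀, ∀ k x a, g i k (Function.update x i a) = g i k x) (hK : K < ⊤)
    (hbox : ∀ i ∈ e.erase i₀, ∀ k,
      ∫⁻ z, dup (insert j (e.erase i)) (fun z => ‖g i k (origin z)‖ₑ ^ s) z
        ∂(copyMeasure μ ℓ) ≤ K ^ (s * (ℓ : ℝ) ^ e.card))
    (hint : ∀ k, Integrable (dup (insert j (e.erase i₀)) fun z => F k (origin z))
      (copyMeasure μ ℓ)) {a : Fin ℓ → ℝ≥0∞}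
    (ha : ∀ k, ‖∫ z, dup (insert j (e.erase i₀)) (fun z => F k (origin z)) z
      ∂(copyMeasure μ ℓ)‖ₑ ≤ a k ^ ℓ ^ e.card) :
    Integrable (fun z => (∏ k, F k (origin (freeze j k z))) *
      ∏ i ∈ e.erase i₀, ∏ k, g i k (origin (freeze j k z))) (copyMeasure μ ℓ) ∧
    ‖∫ z, (∏ k, F k (origin (freeze j k z))) *
      ∏ i ∈ e.erase i₀, ∏ k, g i k (origin (freeze j k z)) ∂(copyMeasure μ ℓ)‖ₑ ≤
      (∏ k, a k) * K ^ (ℓ * (e.card - 1)) := by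
  have hj' : j ∉ e.erase i₀ := fun h => hj (Finset.mem_of_mem_erase h)
  have hFo : ∀ k, Measurable fun z : Copies X ℓ => F k (origin z) := fun k =>
    (hF k).comp measurable_origin
  have hΦ : Measurable fun z : Copies X ℓ => ∏ k, F k (origin (freeze j k z)) :=
    measurable_prod_freeze j (E := fun k z => F k (origin z)) hFo
  have hdup : ∀ z : Copies X ℓ, dup (e.erase i₀) (fun z => ∏ k, F k (origin (freeze j k z))) z =
      ∏ k, dup (e.erase i₀) (fun z => F k (origin z)) (freeze j k z) := fun z => by
    simp only [dup_prod, dup_freeze_of_notMem hj']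
  have hint1 : Integrable (dup (e.erase i₀) fun z => ∏ k, F k (origin (freeze j k z)))
      (copyMeasure μ ℓ) := by
    refine ⟨(measurable_dup _ hΦ).aestronglyMeasurable, ?_⟩
    have h := lintegral_dup_prod_freeze_le μ hj' (G := fun k z => ‖F k (origin z)‖ₑ)
      fun k => (hFo k).enorm
    simp only [HasFiniteIntegral, enorm_dup, enorm_prod_real]
    refine h.trans_lt (ENNReal.prod_lt_top fun k _ => ENNReal.rpow_lt_top_of_nonneg
      (by positivity) ?_)
    simpa only [enorm_dup] using (hint k).2.ne
  obtain ⟨h1, h2⟩ := integrable_and_enorm_integral_mul_prod_prod_le μ heven hℓ hs hj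
    (Finset.erase_subset i₀ e) hΦ
    (fun i hi z => by
      have : i ≠ j := fun h => hj' (h ▸ hi)
      simp only [origin_freeze_freeze_zero this]) hg hgi hK hbox hint1
  refine ⟨h1, h2.trans ?_⟩
  rw [Finset.card_erase_of_mem hi₀]
  gcongr
  have h3 := enorm_integral_prod_freeze_le μ heven j
    (E := fun k => dup (e.erase i₀) fun z => F k (origin z))
    (fun k => measurable_dup _ (hFo k)) (hint1.congr (Filter.Eventually.of_forall hdup))
    (fun k => (hint k).congr (Filter.Eventually.of_forall (dup_insert hj' _)))
  simp only [hdup]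
  have hc : e.card = (e.card - 1) + 1 := by
    have := Finset.card_pos.2 ⟨i₀, hi₀⟩; omega
  calc _ ≤ (∏ k, (a k ^ ℓ ^ e.card) ^ (ℓ : ℝ)⁻¹) ^ ((ℓ : ℝ) ^ (e.card - 1))⁻¹ := by
        gcongr
        refine h3.trans ?_
        gcongr with k _
        simpa only [dup_insert hj'] using ha k
    _ = ∏ k, a k := by
      rw [← ENNReal.prod_rpow_of_nonneg (by positivity)]
      refine Finset.prod_congr rfl fun k _ => ?_
      rw [hc, pow_succ, pow_mul, pow_rpow_inv_copies]
      exact_mod_cast ENNReal.pow_rpow_inv_natCast (pow_ne_zero _ (NeZero.ne ℓ)) (a k)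

end VonNeumann

/-! ### Families of copies against copies of families. -/

section Reindex

variable {ι : Type*} [Fintype ι] [DecidableEq ι] {X : ι → Type*} [∀ i, MeasurableSpace (X i)]
  (μ : (i : ι) → Measure (X i)) [∀ i, IsProbabilityMeasure (μ i)] {ℓ : ℕ}

omit [DecidableEq ι] in
/-- Copies of families are families of copies. -/
theorem measurePreserving_copies {κ : Type*} [Fintype κ] {σ : κ → ι} (hσ : Function.Injective σ) :
    MeasurePreserving (fun (z : Copies X ℓ) (k : Fin ℓ) (c : κ) => z (σ c) k) (copyMeasure μ ℓ)
      (Measure.pi fun _ => Measure.pi fun c => μ (σ c)) := by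
  have hm : Measurable (fun (z : Copies X ℓ) (k : Fin ℓ) (c : κ) => z (σ c) k) := by fun_prop
  refine ⟨hm, (Measure.pi_eq_generateFrom
    (C := fun _ => Set.pi Set.univ '' Set.pi Set.univ fun c : κ => {t : Set (X (σ c)) | MeasurableSet t})
    (fun _ => generateFrom_pi) (fun _ => isPiSystem_pi)
    (fun _ => ⟨fun _ => Set.univ, fun _ => ?_, fun _ => measure_lt_top _ _, Set.iUnion_const _⟩) fun t ht => ?_).symm⟩
  · exact ⟨fun _ => Set.univ, by simp, by simp⟩
  choose u hu hut using ht
  have hu' : ∀ k c, MeasurableSet (u k c) := fun k c => hu k c (Set.mem_univ c)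
  obtain rfl : t = fun k => Set.univ.pi (u k) := funext fun k => (hut k).symm
  rw [Measure.map_apply hm (MeasurableSet.univ_pi fun k => MeasurableSet.univ_pi (hu' k))]
  -- The constraint on the `k`-th copy of the coordinate `i`: it is `u k c` if `i = σ c`, and void
  -- if `i` is outside the range of `σ`.
  let T : (i : ι) → Fin ℓ → Set (X i) := fun i k => {x | ∀ c, ∀ h : i = σ c, h ▸ x ∈ u k c}
  have hT : ∀ c k, T (σ c) k = u k c := fun c k => by
    ext x
    refine ⟨fun h => h c rfl, fun h c' hc => ?_⟩
    obtain rfl := hσ hc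
    exact h
  have hpre : (fun (z : Copies X ℓ) (k : Fin ℓ) (c : κ) => z (σ c) k) ⁻¹'
      (Set.univ.pi fun k => Set.univ.pi (u k)) = Set.univ.pi fun i => Set.univ.pi (T i) := by
    ext z
    simp only [Set.mem_preimage, Set.mem_univ_pi]
    constructor
    · intro h i k c hc
      subst hc
      exact h k c
    · intro h k c
      exact h (σ c) k c rfl
  rw [hpre, copyMeasure, Measure.pi_pi]
  simp only [Measure.pi_pi]
  rw [Finset.prod_comm]
  symm
  refine Finset.prod_congr rfl fun k _ => ?_
  refine Fintype.prod_of_injective σ hσ _ _ (fun i hi => ?_) fun c => by rw [hT]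
  have : T i k = Set.univ := by
    ext x
    simp only [Set.mem_univ, iff_true]
    intro c h
    exact absurd ⟨c, h.symm⟩ hi
  rw [this, measure_univ]

omit [DecidableEq ι] in
theorem measurePreserving_copy {κ : Type*} [Fintype κ] {σ : κ → ι} (hσ : Function.Injective σ)
    (k : Fin ℓ) :
    MeasurePreserving (fun (z : Copies X ℓ) (c : κ) => z (σ c) k) (copyMeasure μ ℓ)
      (Measure.pi fun c => μ (σ c)) :=
  (measurePreserving_eval (μ := fun _ : Fin ℓ => Measure.pi fun c => μ (σ c)) k).comp
    (measurePreserving_copies μ hσ)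

omit [DecidableEq ι] in
theorem measurePreserving_origin [NeZero ℓ] :
    MeasurePreserving (origin : Copies X ℓ → _) (copyMeasure μ ℓ) (Measure.pi μ) :=
  measurePreserving_copy μ Function.injective_id 0

end Reindex

/-! ### Fibre integrals and box norms expressed through copies. -/

variable {n : ℕ} {X : Fin n → Type u} [∀ i, MeasurableSpace (X i)]
  (μ : (i : Fin n) → Measure (X i)) [∀ i, IsProbabilityMeasure (μ i)] {ℓ : ℕ}

instance (e : Finset (Fin n)) : IsProbabilityMeasure (prodMeasure μ e) := by
  unfold prodMeasure; infer_instance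

theorem measurable_proj (e : Finset (Fin n)) : Measurable (proj (X := X) e) := by
  unfold proj; fun_prop

theorem measurable_glue (e : Finset (Fin n)) :
    Measurable fun q : ProdSpace X e × ProdSpace X eᶜ => glue e q.1 q.2 := by
  refine measurable_pi_lambda _ fun i => ?_
  by_cases h : i ∈ e
  · simp only [glue, h, dif_pos]; fun_prop
  · simp only [glue, h, dif_neg, not_false_eq_true]; fun_prop

theorem measurePreserving_proj (e : Finset (Fin n)) :
    MeasurePreserving (proj (X := X) e) (Measure.pi μ) (prodMeasure μ e) := by
  refine ⟨measurable_proj e, ?_⟩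
  rw [← (measurePreserving_origin (ℓ := 1) μ).map_eq,
    Measure.map_map (measurable_proj e) measurable_origin]
  exact (measurePreserving_copy (ℓ := 1) μ (Subtype.val_injective (p := (· ∈ e))) 0).map_eq

theorem measurePreserving_proj_origin [NeZero ℓ] (e : Finset (Fin n)) :
    MeasurePreserving (fun z : Copies X ℓ => proj e (origin z)) (copyMeasure μ ℓ)
      (prodMeasure μ e) :=
  (measurePreserving_proj μ e).comp (measurePreserving_origin μ)

/-- One copy of the coordinates in `e` and all copies of the remaining ones are independent. -/
theorem measurePreserving_proj_prod_copies [NeZero ℓ] (e : Finset (Fin n)) :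
    MeasurePreserving (fun z : Copies X ℓ => (proj e (origin z),
      fun (k : Fin ℓ) (i : (eᶜ : Finset (Fin n))) => z i k)) (copyMeasure μ ℓ)
      ((prodMeasure μ e).prod (Measure.pi fun _ => prodMeasure μ eᶜ)) := by
  have h1 := measurePreserving_proj_origin (ℓ := ℓ) μ e
  have h2 := measurePreserving_copies (ℓ := ℓ) μ (Subtype.val_injective (p := (· ∈ eᶜ)))
  have hind : ProbabilityTheory.iIndepFun (fun (i : Fin n) (z : Copies X ℓ) => z i)
      (copyMeasure μ ℓ) :=
    ProbabilityTheory.iIndepFun_pi (X := fun i (w : Fin ℓ → X i) => w)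
      fun i => measurable_id.aemeasurable
  have hind2 := (hind.indepFun_finset e eᶜ disjoint_compl_right
    (fun i => measurable_pi_apply i)).comp
      (φ := fun (w : (i : e) → Fin ℓ → X i) (i : e) => w i 0)
      (ψ := fun (w : (i : (eᶜ : Finset (Fin n))) → Fin ℓ → X i) (k : Fin ℓ)
        (i : (eᶜ : Finset (Fin n))) => w i k) (by fun_prop) (by fun_prop)
  refine ⟨h1.measurable.prodMk h2.measurable, ?_⟩
  have h3 := (ProbabilityTheory.indepFun_iff_map_prod_eq_prod_map_map
    h1.measurable.aemeasurable h2.measurable.aemeasurable).1 hind2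
  rw [h3, h1.map_eq, h2.map_eq]
  rfl

/-- A product of `ℓ` fibre integrals is a single integral over `ℓ` independent points of the fibre.
-/
theorem integrable_and_integral_mul_prod_fibre [NeZero ℓ] (e : Finset (Fin n))
    {F : ProdSpace X e → ℝ} (hF : Measurable F) {Φ : Fin ℓ → ((i : Fin n) → X i) → ℝ}
    (hΦ : ∀ k, Measurable (Φ k))
    (hint : Integrable (fun z : Copies X ℓ => F (proj e (origin z)) *
      ∏ k, Φ k (glue e (proj e (origin z)) fun i => z i k)) (copyMeasure μ ℓ)) :
    Integrable (fun x => F x * ∏ k, ∫ y, Φ k (glue e x y) ∂(prodMeasure μ eᶜ))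
      (prodMeasure μ e) ∧
    ∫ x, F x * ∏ k, ∫ y, Φ k (glue e x y) ∂(prodMeasure μ eᶜ) ∂(prodMeasure μ e) =
      ∫ z : Copies X ℓ, F (proj e (origin z)) *
        ∏ k, Φ k (glue e (proj e (origin z)) fun i => z i k) ∂(copyMeasure μ ℓ) := by
  have hmp := measurePreserving_proj_prod_copies (ℓ := ℓ) μ e
  let Ψ : ProdSpace X e × (Fin ℓ → ProdSpace X eᶜ) → ℝ :=
    fun q => F q.1 * ∏ k, Φ k (glue e q.1 (q.2 k))
  have hΨ : Measurable Ψ := by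
    refine (hF.comp measurable_fst).mul (Finset.measurable_fun_prod _ fun k _ => ?_)
    have : Measurable fun q : ProdSpace X e × (Fin ℓ → ProdSpace X eᶜ) => (q.1, q.2 k) := by
      fun_prop
    exact (hΦ k).comp ((measurable_glue e).comp this)
  have hintΨ := (hmp.integrable_comp hΨ.aestronglyMeasurable).1 hint
  -- This holds at every `x`, also where a fibre integral takes its default value, so no exceptional
  -- null set arises.
  have hfib : ∀ x, F x * ∏ k, ∫ y, Φ k (glue e x y) ∂(prodMeasure μ eᶜ) =
      ∫ y, Ψ (x, y) ∂(Measure.pi fun _ => prodMeasure μ eᶜ) := fun x => by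
    simp only [Ψ]
    rw [integral_const_mul, integral_fintype_prod_eq_prod (μ := fun _ : Fin ℓ => prodMeasure μ eᶜ)
      (fun k y => Φ k (glue e x y))]
  simp only [hfib]
  refine ⟨hintΨ.integral_prod_left, ?_⟩
  rw [← integral_prod _ hintΨ, ← hmp.map_eq,
    integral_map hmp.measurable.aemeasurable hΨ.aestronglyMeasurable]

omit [(i : Fin n) → MeasurableSpace (X i)] in
theorem prod_mix_eq_dup [NeZero ℓ] {R : Type*} [CommMonoid R] (e : Finset (Fin n))
    (F : ProdSpace X e → R) (z : Copies X ℓ) :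
    ∏ ω : e → Fin ℓ, F (mix ω fun k i => z i k) = dup e (fun z => F (proj e (origin z))) z := by
  unfold dup
  symm
  refine Finset.prod_bij' (fun ω _ (i : e) => ω i)
    (fun ω _ i => if h : i ∈ e then ω ⟨i, h⟩ else 0) ?_ ?_ ?_ ?_ ?_
  · intro ω _; exact Finset.mem_univ _
  · intro ω _
    simp only [choices, Fintype.mem_piFinset]
    intro i
    by_cases h : i ∈ e <;> simp [h]
  · intro ω hω
    simp only [choices, Fintype.mem_piFinset] at hω
    funext i
    by_cases h : i ∈ e
    · simp [h]
    · have := hω i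
      simp only [h, if_false, Finset.mem_singleton] at this
      simp [h, this]
  · intro ω _
    funext i
    simp
  · intro ω _
    refine congrArg F ?_
    funext i
    simp [proj, origin, select, mix]

variable [NeZero ℓ] {e : Finset (Fin n)} {F : ProdSpace X e → ℝ}

omit [NeZero ℓ] in
theorem measurable_prod_mix {R : Type*} [CommMonoid R] [MeasurableSpace R] [MeasurableMul₂ R]
    {F : ProdSpace X e → R} (hF : Measurable F) :
    Measurable fun x : Fin ℓ → ProdSpace X e => ∏ ω : e → Fin ℓ, F (mix ω x) := by
  refine Finset.measurable_fun_prod _ fun ω _ => hF.comp ?_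
  unfold mix; fun_prop

omit [NeZero ℓ] in
theorem measurePreserving_copies_prodSpace (e : Finset (Fin n)) :
    MeasurePreserving (fun (z : Copies X ℓ) (k : Fin ℓ) (i : e) => z i k) (copyMeasure μ ℓ)
      (Measure.pi fun _ => prodMeasure μ e) :=
  measurePreserving_copies μ (Subtype.val_injective (p := (· ∈ e)))

theorem integrable_prod_mix_iff (hF : Measurable F) :
    Integrable (fun x : Fin ℓ → ProdSpace X e => ∏ ω : e → Fin ℓ, F (mix ω x))
      (Measure.pi fun _ => prodMeasure μ e) ↔
    Integrable (dup e fun z : Copies X ℓ => F (proj e (origin z))) (copyMeasure μ ℓ) := by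
  rw [← (measurePreserving_copies_prodSpace μ e).integrable_comp
    (measurable_prod_mix hF).aestronglyMeasurable]
  refine integrable_congr (Filter.Eventually.of_forall fun z => ?_)
  exact prod_mix_eq_dup e F z

theorem integral_prod_mix (hF : Measurable F) :
    ∫ x : Fin ℓ → ProdSpace X e, ∏ ω : e → Fin ℓ, F (mix ω x)
      ∂(Measure.pi fun _ => prodMeasure μ e) =
    ∫ z : Copies X ℓ, dup e (fun z => F (proj e (origin z))) z ∂(copyMeasure μ ℓ) := by
  have h := measurePreserving_copies_prodSpace (ℓ := ℓ) μ e
  rw [← h.map_eq, integral_map h.measurable.aemeasurable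
    (measurable_prod_mix hF).aestronglyMeasurable]
  exact integral_congr_ae (Filter.Eventually.of_forall fun z => prod_mix_eq_dup e F z)

/-- Singling out one coordinate of `e` exhibits the integral as that of an ℓ-th power with `ℓ` even;
this is where `e` must be nonempty. -/
theorem integral_dup_nonneg (heven : Even ℓ) (he : e.Nonempty) (hF : Measurable F)
    (hint : Integrable (dup e fun z : Copies X ℓ => F (proj e (origin z))) (copyMeasure μ ℓ)) :
    0 ≤ ∫ z : Copies X ℓ, dup e (fun z => F (proj e (origin z))) z ∂(copyMeasure μ ℓ) := by
  obtain ⟨i, hi⟩ := he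
  have hins := fun z => dup_insert (Finset.notMem_erase i e)
    (fun z : Copies X ℓ => F (proj e (origin z))) z
  rw [Finset.insert_erase hi] at hins
  simp only [hins]
  refine integral_prod_freeze_nonneg μ heven i (measurable_dup _ (hF.comp
    ((measurable_proj e).comp measurable_origin))) ?_
  exact hint.congr (Filter.Eventually.of_forall hins)

theorem integrable_and_enorm_integral_le_of_boxNorm_le (heven : Even ℓ) (he : e.Nonempty)
    (hF : Measurable F) {a : ℝ≥0∞} (ha : a < ⊤) (h : boxNorm μ e ℓ F ≤ a) :
    Integrable (dup e fun z : Copies X ℓ => F (proj e (origin z))) (copyMeasure μ ℓ) ∧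
    ‖∫ z : Copies X ℓ, dup e (fun z => F (proj e (origin z))) z ∂(copyMeasure μ ℓ)‖ₑ ≤
      a ^ ℓ ^ e.card := by
  unfold boxNorm at h
  split_ifs at h with hint
  · have hint' := (integrable_prod_mix_iff μ hF).1 hint
    have h0 := integral_dup_nonneg μ heven he hF hint'
    refine ⟨hint', ?_⟩
    rw [integral_prod_mix μ hF, ← ENNReal.ofReal_rpow_of_nonneg h0 (by positivity),
      ← Real.enorm_of_nonneg h0, one_div] at h
    calc _ = (‖∫ z : Copies X ℓ, dup e (fun z => F (proj e (origin z))) z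
          ∂(copyMeasure μ ℓ)‖ₑ ^ ((ℓ : ℝ) ^ e.card)⁻¹) ^ ℓ ^ e.card := by
          symm
          exact_mod_cast ENNReal.rpow_inv_natCast_pow (pow_ne_zero e.card (NeZero.ne ℓ)) _
      _ ≤ _ := by gcongr
  · exact absurd (h.trans_lt ha) (lt_irrefl _)

/-- For finite `p`, monotonicity of L-norms on a probability space is applied to the whole
duplicated product. For `p = ∞`, the essential bound is applied at each vertex. -/
theorem lintegral_dup_rpow_le_of_boxNormLp_le {p : ℝ≥0∞} {s : ℝ} (hs : 1 ≤ s)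
    (hsp : ENNReal.ofReal s ≤ p) (hF : Measurable F) {K : ℝ≥0∞} (hK : K < ⊤)
    (h : boxNormLp μ e ℓ p F ≤ K) :
    ∫⁻ z : Copies X ℓ, dup e (fun z => ‖F (proj e (origin z))‖ₑ ^ s) z ∂(copyMeasure μ ℓ) ≤
      K ^ (s * (ℓ : ℝ) ^ e.card) := by
  have hs0 : 0 < s := by linarith
  unfold boxNormLp at h
  split_ifs at h with hp
  · have hae : ∀ᵐ x ∂(prodMeasure μ e), ‖F x‖ₑ ≤ K := by
      rw [eLpNorm_exponent_top] at h
      filter_upwards [ae_le_eLpNormEssSup (f := F) (μ := prodMeasure μ e)] with x hx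
      exact hx.trans h
    -- Each vertex of the box is itself distributed by `prodMeasure μ e`, so the exceptional null
    -- set is avoided at all the finitely many vertices.
    have hsel : ∀ ω : Fin n → Fin ℓ,
        ∀ᵐ z ∂(copyMeasure μ ℓ), ‖F (proj e (origin (select e ω z)))‖ₑ ≤ K := fun ω => by
      have hmp : MeasurePreserving (fun z : Copies X ℓ => proj e (origin (select e ω z)))
          (copyMeasure μ ℓ) (prodMeasure μ e) := by
        have hpi := measurePreserving_pi (fun i : Fin n => Measure.pi fun _ : Fin ℓ => μ i) μ
          (f := fun i w => w (ω i)) fun i => measurePreserving_eval (μ := fun _ : Fin ℓ => μ i) _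
        have := (measurePreserving_proj μ e).comp hpi
        convert this using 1
        · funext z i
          simp [proj, origin, select]
        · rfl
      exact hmp.quasiMeasurePreserving.ae hae
    have hall : ∀ᵐ z ∂(copyMeasure μ ℓ), ∀ ω : Fin n → Fin ℓ,
        ‖F (proj e (origin (select e ω z)))‖ₑ ≤ K := Filter.eventually_all.2 hsel
    calc _ ≤ ∫⁻ _z : Copies X ℓ, K ^ (s * (ℓ : ℝ) ^ e.card) ∂(copyMeasure μ ℓ) := by
          refine lintegral_mono_ae ?_
          filter_upwards [hall] with z hz
          calc _ ≤ ∏ _ω ∈ choices (ℓ := ℓ) e, K ^ s := by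
                refine Finset.prod_le_prod' fun ω _ => ?_
                exact ENNReal.rpow_le_rpow (hz ω) hs0.le
            _ = _ := by
                rw [Finset.prod_const, card_choices, ENNReal.rpow_mul, ← Nat.cast_pow,
                  ENNReal.rpow_natCast]
      _ = _ := by simp
  · have hp0 : 0 < p.toReal := by
      refine ENNReal.toReal_pos (fun h0 => ?_) hp
      rw [h0, nonpos_iff_eq_zero, ENNReal.ofReal_eq_zero] at hsp
      linarith
    have hsp' : s ≤ p.toReal := (ENNReal.ofReal_le_iff_le_toReal hp).1 hsp
    have hFp : Measurable fun x => |F x| ^ p.toReal := hF.abs.pow_const _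
    have h' : boxNorm μ e ℓ (fun x => |F x| ^ p.toReal) ≤ K ^ p.toReal := by
      calc _ = (boxNorm μ e ℓ (fun x => |F x| ^ p.toReal) ^ (1 / p.toReal)) ^ p.toReal := by
            rw [← ENNReal.rpow_mul, one_div, inv_mul_cancel₀ hp0.ne', ENNReal.rpow_one]
        _ ≤ _ := by gcongr
    have hKp : K ^ p.toReal < ⊤ := ENNReal.rpow_lt_top_of_nonneg hp0.le hK.ne
    have hmain : ∫⁻ z : Copies X ℓ, dup e (fun z => ‖F (proj e (origin z))‖ₑ ^ p.toReal) z
        ∂(copyMeasure μ ℓ) ≤ K ^ (p.toReal * (ℓ : ℝ) ^ e.card) := by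
      unfold boxNorm at h'
      split_ifs at h' with hint
      · have hint' := (integrable_prod_mix_iff μ hFp).1 hint
        have hpos : ∀ z : Copies X ℓ,
            0 ≤ dup e (fun z => |F (proj e (origin z))| ^ p.toReal) z := fun z =>
          Finset.prod_nonneg fun ω _ => by positivity
        have h0 : 0 ≤ ∫ z : Copies X ℓ, dup e (fun z => |F (proj e (origin z))| ^ p.toReal) z
            ∂(copyMeasure μ ℓ) := integral_nonneg hpos
        rw [integral_prod_mix μ hFp, ← ENNReal.ofReal_rpow_of_nonneg h0 (by positivity),
          ← Real.enorm_of_nonneg h0, one_div,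
          enorm_eq_lintegral_enorm_of_nonneg hint' hpos] at h'
        have he : ∀ z : Copies X ℓ, ‖|F (proj e (origin z))| ^ p.toReal‖ₑ =
            ‖F (proj e (origin z))‖ₑ ^ p.toReal := fun z => by
          rw [Real.enorm_rpow_of_nonneg (abs_nonneg _) hp0.le, Real.enorm_abs]
        simp only [enorm_dup, he] at h'
        calc _ = ((∫⁻ z : Copies X ℓ, dup e (fun z => ‖F (proj e (origin z))‖ₑ ^ p.toReal) z
              ∂(copyMeasure μ ℓ)) ^ ((ℓ : ℝ) ^ e.card)⁻¹) ^ ℓ ^ e.card := by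
              symm
              exact_mod_cast ENNReal.rpow_inv_natCast_pow (pow_ne_zero e.card (NeZero.ne ℓ)) _
          _ ≤ (K ^ p.toReal) ^ ℓ ^ e.card := by gcongr
          _ = _ := by
            rw [ENNReal.rpow_mul, ← Nat.cast_pow, ENNReal.rpow_natCast]
      · exact absurd (h'.trans_lt hKp) (lt_irrefl _)
    have hFm : Measurable fun z : Copies X ℓ => ‖F (proj e (origin z))‖ₑ :=
      (hF.comp ((measurable_proj e).comp measurable_origin)).enorm
    have hjen : ∫⁻ z : Copies X ℓ, dup e (fun z => ‖F (proj e (origin z))‖ₑ) z ^ s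
        ∂(copyMeasure μ ℓ) ≤ (∫⁻ z : Copies X ℓ,
          dup e (fun z => ‖F (proj e (origin z))‖ₑ) z ^ p.toReal
          ∂(copyMeasure μ ℓ)) ^ (s / p.toReal) := by
      have h1 := eLpNorm'_le_eLpNorm'_of_exponent_le (μ := copyMeasure μ ℓ) hs0 hsp'
        (f := dup e (fun z : Copies X ℓ => ‖F (proj e (origin z))‖ₑ))
        (measurable_dup e hFm).aestronglyMeasurable
      simp only [eLpNorm', enorm_eq_self] at h1
      calc _ = ((∫⁻ z : Copies X ℓ, dup e (fun z => ‖F (proj e (origin z))‖ₑ) z ^ s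
            ∂(copyMeasure μ ℓ)) ^ (1 / s)) ^ s := by
            rw [← ENNReal.rpow_mul, one_div, inv_mul_cancel₀ hs0.ne', ENNReal.rpow_one]
        _ ≤ ((∫⁻ z : Copies X ℓ, dup e (fun z => ‖F (proj e (origin z))‖ₑ) z ^ p.toReal
            ∂(copyMeasure μ ℓ)) ^ (1 / p.toReal)) ^ s := by gcongr
        _ = _ := by rw [← ENNReal.rpow_mul]; congr 1; ring
    simp only [← dup_rpow _ _ hp0.le, ← dup_rpow _ _ hs0.le] at hjen
    refine hjen.trans ?_
    calc _ ≤ (K ^ (p.toReal * (ℓ : ℝ) ^ e.card)) ^ (s / p.toReal) := by gcongr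
      _ = _ := by rw [← ENNReal.rpow_mul]; congr 1; field_simp

/-- The `L_p` norm is the box integral with no coordinate duplicated, so monotonicity in the set of
duplicated coordinates applies. -/
theorem eLpNorm_comp_proj_le_of_boxNormLp_le (hℓ : 1 < ℓ) {p : ℝ≥0∞} (hp : 1 ≤ p)
    (hF : Measurable F) {K : ℝ≥0∞} (hK : K < ⊤) (h : boxNormLp μ e ℓ p F ≤ K) :
    eLpNorm (F ∘ proj e) p (Measure.pi μ) ≤ K := by
  by_cases hpt : p = ⊤
  · rw [eLpNorm_comp_measurePreserving hF.aestronglyMeasurable (measurePreserving_proj μ e)]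
    simpa [boxNormLp, hpt] using h
  have hp0 : p ≠ 0 := (zero_lt_one.trans_le hp).ne'
  have hp1 : 1 ≤ p.toReal := by
    rw [← ENNReal.toReal_one]; exact ENNReal.toReal_mono hpt hp
  have hm : Measurable fun x : (i : Fin n) → X i => ‖F (proj e x)‖ₑ ^ p.toReal :=
    (hF.comp (measurable_proj e)).enorm.pow_const _
  have h1 := lintegral_dup_rpow_le_of_boxNormLp_le μ hp1 (ENNReal.ofReal_toReal hpt).le hF hK h
  have h2 := lintegral_dup_le μ (Finset.empty_subset e) hℓ
    (G := fun z => ‖F (proj e (origin z))‖ₑ ^ p.toReal) (hm.comp measurable_origin)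
    (fun i _ z => by rw [origin_freeze_zero])
  rw [eLpNorm_eq_lintegral_rpow_enorm_toReal hp0 hpt]
  simp only [Function.comp, dup_empty, Finset.sdiff_empty] at h2 ⊢
  rw [(measurePreserving_origin (ℓ := ℓ) μ).lintegral_comp hm] at h2
  have hℓ0 : (ℓ : ℝ) ≠ 0 := by exact_mod_cast NeZero.ne ℓ
  calc _ ≤ ((K ^ (p.toReal * (ℓ : ℝ) ^ e.card)) ^ ((ℓ : ℝ) ^ e.card)⁻¹) ^ (1 / p.toReal) := by
        gcongr
        exact h2.trans (by gcongr)
    _ = K := by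
      rw [← ENNReal.rpow_mul, ← ENNReal.rpow_mul]
      convert ENNReal.rpow_one K using 2
      have : p.toReal ≠ 0 := by positivity
      field_simp

/-! ### Edges indexed by their missing vertex, and replacement of factors. -/

section Coedge

variable {n : ℕ} {X : Fin n → Type u} [∀ i, MeasurableSpace (X i)]
  (μ : (i : Fin n) → Measure (X i)) [∀ i, IsProbabilityMeasure (μ i)] (ℓ : ℕ) [NeZero ℓ]

/-- A function on the full product that does not depend on the coordinate `i` and whose
`(ℓ, s)`-box norm in the other coordinates is at most `K`. -/
structure HolderBounded (s : ℝ) (K : ℝ≥0∞) (i : Fin n) (f : ((i : Fin n) → X i) → ℝ) : Prop where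
  measurable : Measurable f
  update_eq : ∀ x a, f (Function.update x i a) = f x
  lintegral_le : ∫⁻ z : Copies X ℓ, dup (Finset.univ.erase i) (fun z => ‖f (origin z)‖ₑ ^ s) z
    ∂(copyMeasure μ ℓ) ≤ K ^ (s * (ℓ : ℝ) ^ (n - 1))

/-- A function on the full product that does not depend on the coordinate `i` and whose
`ℓ`-box norm in the other coordinates is at most `a`. -/
structure BoxBounded (a : ℝ≥0∞) (i : Fin n) (f : ((i : Fin n) → X i) → ℝ) : Prop where
  measurable : Measurable f
  update_eq : ∀ x a, f (Function.update x i a) = f x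
  integrable : Integrable (dup (Finset.univ.erase i) fun z : Copies X ℓ => f (origin z))
    (copyMeasure μ ℓ)
  enorm_integral_le : ‖∫ z : Copies X ℓ, dup (Finset.univ.erase i) (fun z => f (origin z)) z
    ∂(copyMeasure μ ℓ)‖ₑ ≤ a ^ ℓ ^ (n - 1)

variable {μ ℓ} {s : ℝ} {K : ℝ≥0∞} {i j : Fin n} {f : ((i : Fin n) → X i) → ℝ}

omit [∀ (i : Fin n), IsProbabilityMeasure (μ i)] in
theorem HolderBounded.mono (hs : 0 ≤ s) (hf : HolderBounded μ ℓ s K i f)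
    {g : ((i : Fin n) → X i) → ℝ} (hg : Measurable g)
    (hgi : ∀ x a, g (Function.update x i a) = g x) (hgf : ∀ x, ‖g x‖ₑ ≤ ‖f x‖ₑ) :
    HolderBounded μ ℓ s K i g :=
  ⟨hg, hgi, (lintegral_mono fun _ => Finset.prod_le_prod' fun _ _ =>
    ENNReal.rpow_le_rpow (hgf _) hs).trans hf.lintegral_le⟩

theorem holderBounded_one (hK : 1 ≤ K) (hs : 0 ≤ s) (i : Fin n) :
    HolderBounded μ ℓ s K i fun _ => 1 := by
  refine ⟨measurable_const, fun _ _ => rfl, ?_⟩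
  have : (1 : ℝ≥0∞) ≤ K ^ (s * (ℓ : ℝ) ^ (n - 1)) := by
    simpa using ENNReal.rpow_le_rpow_of_exponent_le hK
      (show 0 ≤ s * (ℓ : ℝ) ^ (n - 1) by positivity)
  simpa [dup] using this

/-- Since `s ≥ 1`, a Hölder-bounded factor may also take the distinguished place. This gives
integrability of products that contain no small factor. -/
theorem HolderBounded.boxBounded (hs : 1 ≤ s) (hK : K < ⊤) (hf : HolderBounded μ ℓ s K i f) :
    BoxBounded μ ℓ K i f := by
  have hs0 : 0 < s := by linarith
  have hm : Measurable (dup (Finset.univ.erase i) fun z : Copies X ℓ => f (origin z)) :=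
    measurable_dup _ (hf.measurable.comp measurable_origin)
  have hle : ∫⁻ z : Copies X ℓ, ‖dup (Finset.univ.erase i) (fun z => f (origin z)) z‖ₑ
      ∂(copyMeasure μ ℓ) ≤ K ^ ℓ ^ (n - 1) := by
    have h1 := eLpNorm'_le_eLpNorm'_of_exponent_le (μ := copyMeasure μ ℓ) zero_lt_one hs
      hm.aestronglyMeasurable
    simp only [eLpNorm', ENNReal.rpow_one, one_div, inv_one] at h1
    refine h1.trans ?_
    calc _ ≤ (K ^ (s * (ℓ : ℝ) ^ (n - 1))) ^ s⁻¹ := by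
          gcongr
          simpa only [enorm_dup, dup_rpow _ _ hs0.le] using hf.lintegral_le
      _ = _ := by
          rw [← ENNReal.rpow_mul, ← ENNReal.rpow_natCast]
          congr 1
          push_cast
          field_simp
  exact ⟨hf.measurable, hf.update_eq, ⟨hm.aestronglyMeasurable, hle.trans_lt
    (ENNReal.pow_lt_top hK)⟩, (enorm_integral_le_lintegral_enorm _).trans hle⟩

theorem insert_erase_univ_erase (h : i ≠ j) :
    insert j ((Finset.univ.erase j).erase i) = Finset.univ.erase i := by
  ext k
  simp only [Finset.mem_insert, Finset.mem_erase, Finset.mem_univ, and_true]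
  by_cases hk : k = j
  · subst hk; simp [h.symm]
  · simp [hk]

theorem card_univ_erase (j : Fin n) : (Finset.univ.erase j).card = n - 1 := by
  simp [Finset.card_erase_of_mem]

theorem BoxBounded.integral_mul_prod_le (heven : Even ℓ) (hℓ : 1 < ℓ) (hs : s.HolderConjugate ℓ)
    (hK : K < ⊤) {a : ℝ≥0∞} {F : ((i : Fin n) → X i) → ℝ} (hF : BoxBounded μ ℓ a j F)
    {g : Fin n → Fin ℓ → ((i : Fin n) → X i) → ℝ}
    (hg : ∀ i ≠ j, ∀ k, HolderBounded μ ℓ s K i (g i k)) :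
    Integrable (fun z : Copies X ℓ =>
      F (origin z) * ∏ i ∈ Finset.univ.erase j, ∏ k, g i k (origin (freeze j k z)))
      (copyMeasure μ ℓ) ∧
    ‖∫ z : Copies X ℓ,
      F (origin z) * ∏ i ∈ Finset.univ.erase j, ∏ k, g i k (origin (freeze j k z))
      ∂(copyMeasure μ ℓ)‖ₑ ≤ a * K ^ (ℓ * (n - 1)) := by
  have hne : ∀ i ∈ Finset.univ.erase j, i ≠ j := fun i hi => Finset.ne_of_mem_erase hi
  have h := dup_origin_integral_le μ heven hℓ hs (Finset.notMem_erase j Finset.univ)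
    hF.measurable (fun i hi k => (hg i (hne i hi) k).measurable)
    (fun i hi k => (hg i (hne i hi) k).update_eq) hK
    (fun i hi k => by
      rw [insert_erase_univ_erase (hne i hi), card_univ_erase]
      exact (hg i (hne i hi) k).lintegral_le)
    hF.integrable (by rw [card_univ_erase]; exact hF.enorm_integral_le)
  rwa [card_univ_erase] at h

/-- An ordinary average uses one copy of `j`; the factors at the other copies are taken to be `1`,
which is why `1 ≤ K` is needed. -/
theorem BoxBounded.integral_mul_prod_pi_le (heven : Even ℓ) (hℓ : 1 < ℓ)
    (hs : s.HolderConjugate ℓ) (hK : K < ⊤) (hK1 : 1 ≤ K) {a : ℝ≥0∞}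
    {F : ((i : Fin n) → X i) → ℝ} (hF : BoxBounded μ ℓ a j F)
    {u : Fin n → ((i : Fin n) → X i) → ℝ} (hu : ∀ i ≠ j, HolderBounded μ ℓ s K i (u i)) :
    Integrable (fun x => F x * ∏ i ∈ Finset.univ.erase j, u i x) (Measure.pi μ) ∧
    ‖∫ x, F x * ∏ i ∈ Finset.univ.erase j, u i x ∂(Measure.pi μ)‖ₑ ≤ a * K ^ (ℓ * (n - 1)) := by
  have h := hF.integral_mul_prod_le heven hℓ hs hK
    (g := fun i k => if k = 0 then u i else fun _ => 1) (fun i hi k => by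
      split_ifs
      · exact hu i hi
      · exact holderBounded_one hK1 hs.nonneg i)
  have hk : ∀ i (z : Copies X ℓ), ∏ k, (if k = 0 then u i else fun _ => 1)
      (origin (freeze j k z)) = u i (origin z) := fun i z => by
    rw [Finset.prod_eq_single 0 (fun k _ hk => by simp [hk]) (by simp), if_pos rfl,
      origin_freeze_zero]
  simp only [hk] at h
  have hmp := measurePreserving_origin (ℓ := ℓ) μ
  have hm : Measurable fun x => F x * ∏ i ∈ Finset.univ.erase j, u i x :=
    hF.measurable.mul (Finset.measurable_fun_prod _ fun i hi =>
      (hu i (Finset.ne_of_mem_erase hi)).measurable)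
  refine ⟨(hmp.integrable_comp hm.aestronglyMeasurable).1 h.1, ?_⟩
  rw [← hmp.map_eq, integral_map hmp.measurable.aemeasurable hm.aestronglyMeasurable]
  exact h.2

theorem integral_prod_prod_freeze_le (heven : Even ℓ) (hℓ : 1 < ℓ) (hs : s.HolderConjugate ℓ)
    (hK : K < ⊤) (hij : i ≠ j) {a : Fin ℓ → ℝ≥0∞}
    {g : Fin n → Fin ℓ → ((i : Fin n) → X i) → ℝ} (hgi : ∀ k, BoxBounded μ ℓ (a k) i (g i k))
    (hg : ∀ i' ≠ j, i' ≠ i → ∀ k, HolderBounded μ ℓ s K i' (g i' k)) :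
    Integrable (fun z : Copies X ℓ =>
      ∏ i ∈ Finset.univ.erase j, ∏ k, g i k (origin (freeze j k z))) (copyMeasure μ ℓ) ∧
    ‖∫ z : Copies X ℓ, ∏ i ∈ Finset.univ.erase j, ∏ k, g i k (origin (freeze j k z))
      ∂(copyMeasure μ ℓ)‖ₑ ≤ (∏ k, a k) * K ^ (ℓ * (n - 1 - 1)) := by
  have hi : i ∈ Finset.univ.erase j := Finset.mem_erase.2 ⟨hij, Finset.mem_univ i⟩
  have hne : ∀ i' ∈ (Finset.univ.erase j).erase i, i' ≠ j := fun i' hi' =>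
    Finset.ne_of_mem_erase (Finset.mem_of_mem_erase hi')
  have hne' : ∀ i' ∈ (Finset.univ.erase j).erase i, i' ≠ i := fun i' hi' =>
    Finset.ne_of_mem_erase hi'
  have h := dup_prod_freeze_integral_le μ heven hℓ hs (Finset.notMem_erase j Finset.univ) hi
    (F := g i) (g := g) (fun k => (hgi k).measurable)
    (fun i' hi' k => (hg i' (hne i' hi') (hne' i' hi') k).measurable)
    (fun i' hi' k => (hg i' (hne i' hi') (hne' i' hi') k).update_eq) hK
    (fun i' hi' k => by
      rw [insert_erase_univ_erase (hne i' hi'), card_univ_erase]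
      exact (hg i' (hne i' hi') (hne' i' hi') k).lintegral_le)
    (a := a) (fun k => by rw [insert_erase_univ_erase hij]; exact (hgi k).integrable)
    (fun k => by
      rw [insert_erase_univ_erase hij, card_univ_erase]; exact (hgi k).enorm_integral_le)
  rw [card_univ_erase] at h
  have hprod : ∀ z : Copies X ℓ,
      ∏ i ∈ Finset.univ.erase j, ∏ k, g i k (origin (freeze j k z)) =
      (∏ k, g i k (origin (freeze j k z))) *
        ∏ i ∈ (Finset.univ.erase j).erase i, ∏ k, g i k (origin (freeze j k z)) := fun z =>
    (Finset.mul_prod_erase _ _ hi).symm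
  simpa only [hprod] using h

theorem abs_sub_le_card_mul {α : Type*} [DecidableEq α] (I : Finset α → ℝ) {ε : ℝ} {T : Finset α}
    (h : ∀ A ⊆ T, ∀ x ∈ T, x ∉ A → |I A - I (insert x A)| ≤ ε) {A : Finset α} (hA : A ⊆ T) :
    |I ∅ - I A| ≤ A.card * ε := by
  induction A using Finset.induction_on with
  | empty => simp
  | insert x A hx ih =>
    have h1 := h A ((Finset.subset_insert x A).trans hA) x (hA (Finset.mem_insert_self x A)) hx
    have h2 := ih ((Finset.subset_insert x A).trans hA)
    rw [Finset.card_insert_of_notMem hx]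
    push_cast
    have := abs_sub_le (I ∅) (I A) (I (insert x A))
    linarith

/-- Replacing the factors of a product one at a time changes its average by little. -/
theorem abs_integral_prod_sub_le (heven : Even ℓ) (hℓ : 1 < ℓ) (hs : s.HolderConjugate ℓ)
    (hK : K < ⊤) {δ : ℝ≥0∞} {ε : ℝ} (hε : 0 ≤ ε) (hδ : δ * K ^ (ℓ * (n - 1)) ≤ ENNReal.ofReal ε)
    (hK1 : 1 ≤ K) {u v : Fin n → ((i : Fin n) → X i) → ℝ}
    (hu : ∀ i, HolderBounded μ ℓ s K i (u i)) (hv : ∀ i, HolderBounded μ ℓ s K i (v i))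
    (huv : ∀ i, BoxBounded μ ℓ δ i fun x => u i x - v i x) [NeZero n] :
    Integrable (fun x => ∏ i, u i x) (Measure.pi μ) ∧
    |∫ x, ∏ i, u i x ∂(Measure.pi μ) - ∫ x, ∏ i, v i x ∂(Measure.pi μ)| ≤ n * ε := by
  let w : Finset (Fin n) → Fin n → ((i : Fin n) → X i) → ℝ :=
    fun A i => if i ∈ A then v i else u i
  have hw : ∀ A i, HolderBounded μ ℓ s K i (w A i) := fun A i => by
    simp only [w]; split_ifs
    · exact hv i
    · exact hu i
  have hmain := fun (A : Finset (Fin n)) (j : Fin n) (a : ℝ≥0∞) (F : ((i : Fin n) → X i) → ℝ)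
    (hF : BoxBounded μ ℓ a j F) =>
    hF.integral_mul_prod_pi_le heven hℓ hs hK hK1 (u := w A) fun i _ => hw A i
  -- Any factor may be distinguished, here the one at `0`.
  have hint : ∀ A, Integrable (fun x => ∏ i, w A i x) (Measure.pi μ) := fun A => by
    refine (hmain A 0 K (w A 0) ((hw A 0).boxBounded hs.lt.le hK)).1.congr
      (Filter.Eventually.of_forall fun x => ?_)
    exact Finset.mul_prod_erase _ (fun i => w A i x) (Finset.mem_univ (0 : Fin n))
  have htel := abs_sub_le_card_mul (fun A => ∫ x, ∏ i, w A i x ∂(Measure.pi μ)) (ε := ε)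
    (T := Finset.univ) ?_ (Finset.subset_univ Finset.univ)
  · refine ⟨by simpa [w] using hint ∅, ?_⟩
    simpa [w] using htel
  intro A _ j _ hj
  -- The two products differ only at `j`, so their difference has the small factor `u j - v j`
  -- there.
  have hsub : ∀ x, (∏ i, w A i x) - ∏ i, w (insert j A) i x =
      (u j x - v j x) * ∏ i ∈ Finset.univ.erase j, w A i x := fun x => by
    rw [← Finset.mul_prod_erase _ (fun i => w A i x) (Finset.mem_univ j),
      ← Finset.mul_prod_erase _ (fun i => w (insert j A) i x) (Finset.mem_univ j), sub_mul]
    congr 1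
    · simp [w, hj]
    · congr 1
      · simp [w]
      · refine Finset.prod_congr rfl fun i hi => ?_
        simp [w, Finset.ne_of_mem_erase hi]
  rw [← integral_sub (hint _) (hint _)]
  simp only [hsub]
  have h := (hmain A j δ _ (huv j)).2.trans hδ
  rwa [← Real.norm_eq_abs, ← ENNReal.ofReal_le_ofReal_iff hε, ofReal_norm]

/-- Replacing the factors of a product of averages one at a time changes it by little. -/
theorem abs_integral_prod_prod_freeze_sub_le (heven : Even ℓ) (hℓ : 1 < ℓ)
    (hs : s.HolderConjugate ℓ)
    (hK : K < ⊤) {δ : ℝ≥0∞} {ε : ℝ} (hε : 0 ≤ ε) (hδ : δ * K ^ (ℓ * (n - 1)) ≤ ENNReal.ofReal ε)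
    (hK1 : 1 ≤ K) {u v : Fin n → ((i : Fin n) → X i) → ℝ}
    (hu : ∀ i, HolderBounded μ ℓ s K i (u i)) (hv : ∀ i, HolderBounded μ ℓ s K i (v i))
    (huv : ∀ i, BoxBounded μ ℓ δ i fun x => u i x - v i x) (hn : 2 ≤ n) (j : Fin n) :
    Integrable (fun z : Copies X ℓ =>
      ∏ i ∈ Finset.univ.erase j, ∏ k, u i (origin (freeze j k z))) (copyMeasure μ ℓ) ∧
    |∫ z : Copies X ℓ, ∏ i ∈ Finset.univ.erase j, ∏ k, u i (origin (freeze j k z))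
        ∂(copyMeasure μ ℓ) -
      ∫ z : Copies X ℓ, ∏ i ∈ Finset.univ.erase j, ∏ k, v i (origin (freeze j k z))
        ∂(copyMeasure μ ℓ)| ≤ ((n - 1) * ℓ : ℕ) * ε := by
  let w : Finset (Fin n × Fin ℓ) → Fin n → Fin ℓ → ((i : Fin n) → X i) → ℝ :=
    fun A i k => if (i, k) ∈ A then v i else u i
  have hw : ∀ A i k, HolderBounded μ ℓ s K i (w A i k) := fun A i k => by
    simp only [w]; split_ifs
    · exact hv i
    · exact hu i
  have hs1 := hs.lt.le
  have hint : ∀ A, Integrable (fun z : Copies X ℓ =>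
      ∏ i ∈ Finset.univ.erase j, ∏ k, w A i k (origin (freeze j k z))) (copyMeasure μ ℓ) := by
    intro A
    obtain ⟨i, hi⟩ : ∃ i : Fin n, i ≠ j := by
      have : Nontrivial (Fin n) := Fin.nontrivial_iff_two_le.2 hn
      exact exists_ne j
    exact (integral_prod_prod_freeze_le heven hℓ hs hK hi (a := fun _ => K)
      (fun k => (hw A i k).boxBounded hs1 hK) fun i' _ _ k => hw A i' k).1
  have htel := abs_sub_le_card_mul (fun A => ∫ z : Copies X ℓ,
      ∏ i ∈ Finset.univ.erase j, ∏ k, w A i k (origin (freeze j k z)) ∂(copyMeasure μ ℓ)) (ε := ε)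
    (T := Finset.univ.erase j ×ˢ Finset.univ) ?_ (Finset.Subset.refl _)
  · refine ⟨by simpa [w] using hint ∅, ?_⟩
    rw [Finset.card_product, card_univ_erase, Finset.card_univ, Fintype.card_fin] at htel
    have h0 : ∀ z : Copies X ℓ, ∏ i ∈ Finset.univ.erase j, ∏ k, w ∅ i k (origin (freeze j k z)) =
        ∏ i ∈ Finset.univ.erase j, ∏ k, u i (origin (freeze j k z)) := fun z => by simp [w]
    have h1 : ∀ z : Copies X ℓ, ∏ i ∈ Finset.univ.erase j, ∏ k,
        w (Finset.univ.erase j ×ˢ Finset.univ) i k (origin (freeze j k z)) =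
        ∏ i ∈ Finset.univ.erase j, ∏ k, v i (origin (freeze j k z)) := fun z => by
      refine Finset.prod_congr rfl fun i hi => Finset.prod_congr rfl fun k _ => ?_
      simp only [w]
      rw [if_pos (Finset.mk_mem_product hi (Finset.mem_univ k))]
    simpa only [h0, h1] using htel
  rintro A _ ⟨i₀, k₀⟩ hik hA
  have hi : i₀ ∈ Finset.univ.erase j := (Finset.mem_product.1 hik).1
  have hsub : ∀ z : Copies X ℓ,
      (∏ i ∈ Finset.univ.erase j, ∏ k, w A i k (origin (freeze j k z))) -
        ∏ i ∈ Finset.univ.erase j, ∏ k, w (insert (i₀, k₀) A) i k (origin (freeze j k z)) =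
      ∏ i' ∈ Finset.univ.erase j, ∏ k', (if (i', k') = (i₀, k₀) then fun x => u i₀ x - v i₀ x
        else w A i' k') (origin (freeze j k' z)) := fun z => by
    simp only [← Finset.prod_product']
    rw [← Finset.mul_prod_erase _ _ hik, ← Finset.mul_prod_erase _ _ hik,
      ← Finset.mul_prod_erase _ (fun q : Fin n × Fin ℓ => (if (q.1, q.2) = (i₀, k₀) then
        fun x => u i₀ x - v i₀ x else w A q.1 q.2) (origin (freeze j q.2 z))) hik]
    rw [if_pos rfl, sub_mul]
    have hc : ∀ B : Fin n × Fin ℓ → ℝ, (∀ q, q ≠ (i₀, k₀) → B q =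
        w A q.1 q.2 (origin (freeze j q.2 z))) →
        ∏ q ∈ (Finset.univ.erase j ×ˢ Finset.univ).erase (i₀, k₀), B q =
        ∏ q ∈ (Finset.univ.erase j ×ˢ Finset.univ).erase (i₀, k₀),
          w A q.1 q.2 (origin (freeze j q.2 z)) := fun B hB =>
      Finset.prod_congr rfl fun q hq => hB q (Finset.ne_of_mem_erase hq)
    rw [hc (fun q => w (insert (i₀, k₀) A) q.1 q.2 (origin (freeze j q.2 z)))
      (fun q hq => by simp only [w, Finset.mem_insert, Prod.mk.eta, hq, false_or]),
      hc (fun q => (if (q.1, q.2) = (i₀, k₀) then fun x => u i₀ x - v i₀ x else w A q.1 q.2)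
        (origin (freeze j q.2 z))) (fun q hq => by simp only [Prod.mk.eta, if_neg hq])]
    simp [w, hA]
  rw [← integral_sub (hint _) (hint _)]
  simp only [hsub]
  -- On the edge missing `i₀` the copy `k₀` carries the small difference and the other `ℓ - 1`
  -- copies carry `K`.
  have h := (integral_prod_prod_freeze_le heven hℓ hs hK (Finset.ne_of_mem_erase hi)
    (a := fun k' => if k' = k₀ then δ else K)
    (g := fun i' k' => if (i', k') = (i₀, k₀) then fun x => u i₀ x - v i₀ x else w A i' k')
    (fun k' => by
      by_cases hk : k' = k₀
      · subst hk; simpa using huv i₀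
      · simpa [hk] using (hw A i₀ k').boxBounded hs1 hK)
    (fun i' _ hi' k' => by simpa [hi'] using hw A i' k')).2
  rw [← Real.norm_eq_abs, ← ENNReal.ofReal_le_ofReal_iff hε, ofReal_norm]
  refine h.trans (le_trans ?_ hδ)
  rw [← Finset.mul_prod_erase _ _ (Finset.mem_univ k₀), if_pos rfl, mul_assoc]
  gcongr
  rw [Finset.prod_congr rfl fun k' hk' => if_neg (Finset.ne_of_mem_erase hk'), Finset.prod_const,
    ← pow_add]
  -- The exponent is `(ℓ - 1) + ℓ(n - 2)`, one less than `ℓ(n - 1)`.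
  refine pow_le_pow_right₀ hK1 ?_
  rw [Finset.card_erase_of_mem (Finset.mem_univ k₀), Finset.card_univ, Fintype.card_fin]
  obtain ⟨m, rfl⟩ : ∃ m, n = m + 2 := ⟨n - 2, by omega⟩
  have : ℓ * (m + 2 - 1) = ℓ * (m + 2 - 1 - 1) + ℓ := by
    rw [show m + 2 - 1 = m + 1 by omega]; simp [mul_add]
  omega

end Coedge

/-! ### The choice of the level `ℓ`. -/

section Levels

/-- From `ℓ ≥ 2q` come `ℓ ≥ 2`, because `q ≥ 1`, and `ℓ ≥ q`, which is the same as saying that the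
conjugate exponent of `ℓ` is at most `p`. -/
theorem boxLevel_spec {C : ℝ} (hC : 1 ≤ C) {p : ℝ≥0∞} (hp : 1 < p) :
    Even (boxLevel C p) ∧ 2 ≤ boxLevel C p ∧
      ENNReal.ofReal (boxLevel C p : ℝ).conjExponent ≤ p := by
  -- Without a member the infimum would be the default value `0`.
  have hne : {m : ℕ | Even m ∧
      2 * p.conjExponent.toReal + (1 - 1 / C) + (1 / p).toReal ≤ m}.Nonempty := by
    refine ⟨2 * ⌈2 * p.conjExponent.toReal + (1 - 1 / C) + (1 / p).toReal⌉₊,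
      even_two_mul _, ?_⟩
    push_cast
    have h1 := Nat.le_ceil (2 * p.conjExponent.toReal + (1 - 1 / C) + (1 / p).toReal)
    have h2 : (0 : ℝ) ≤ ⌈2 * p.conjExponent.toReal + (1 - 1 / C) + (1 / p).toReal⌉₊ :=
      Nat.cast_nonneg _
    linarith
  obtain ⟨heven, hle⟩ : Even (boxLevel C p) ∧
      2 * p.conjExponent.toReal + (1 - 1 / C) + (1 / p).toReal ≤ (boxLevel C p : ℝ) :=
    Nat.sInf_mem hne
  have hC' : 0 ≤ 1 - 1 / C := by
    rw [sub_nonneg, div_le_one (by linarith)]; exact hC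
  have hp' : 0 ≤ (1 / p).toReal := ENNReal.toReal_nonneg
  have hℓ : 2 * p.conjExponent.toReal ≤ (boxLevel C p : ℝ) := by linarith
  have hq : p.conjExponent = 1 + (p - 1)⁻¹ := rfl
  have hq1 : 1 ≤ p.conjExponent.toReal := by
    rw [hq, ENNReal.toReal_add ENNReal.one_ne_top
      (ENNReal.inv_ne_top.2 (tsub_pos_of_lt hp).ne'), ENNReal.toReal_one]
    linarith [ENNReal.toReal_nonneg (a := (p - 1)⁻¹)]
  have hℓ2 : (2 : ℝ) ≤ boxLevel C p := by linarith
  refine ⟨heven, by exact_mod_cast hℓ2, ?_⟩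
  by_cases hpt : p = ⊤
  · simp [hpt]
  rw [ENNReal.ofReal_le_iff_le_toReal hpt, Real.conjExponent]
  have hp1 : 1 < p.toReal := by
    rw [← ENNReal.toReal_one]; exact (ENNReal.toReal_lt_toReal ENNReal.one_ne_top hpt).2 hp
  have hqr : p.conjExponent.toReal = 1 + (p.toReal - 1)⁻¹ := by
    rw [hq, ENNReal.toReal_add ENNReal.one_ne_top
      (ENNReal.inv_ne_top.2 (tsub_pos_of_lt hp).ne'), ENNReal.toReal_inv,
      ENNReal.toReal_sub_of_le hp.le hpt, ENNReal.toReal_one]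
  rw [hqr] at hℓ
  rw [div_le_iff₀ (by linarith)]
  have hpos : 0 < p.toReal - 1 := by linarith
  have h1 : 1 + (p.toReal - 1)⁻¹ ≤ boxLevel C p := by
    have : 0 < (p.toReal - 1)⁻¹ := by positivity
    linarith
  have h2 := mul_le_mul_of_nonneg_left h1 hpos.le
  rw [mul_add, mul_inv_cancel₀ hpos.ne'] at h2
  linarith

end Levels

/-! ### The complete (n-1)-uniform hypergraph and its edge functions. -/

section Complete

variable {n : ℕ}

theorem mem_completeHypergraph (hn : 1 ≤ n) {e : Finset (Fin n)} :
    e ∈ completeHypergraph n ↔ ∃ j, e = Finset.univ.erase j := by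
  rw [completeHypergraph, Finset.mem_powersetCard]
  constructor
  · rintro ⟨-, h⟩
    have hc : eᶜ.card = 1 := by rw [Finset.card_compl, h, Fintype.card_fin]; omega
    obtain ⟨j, hj⟩ := Finset.card_eq_one.1 hc
    refine ⟨j, ?_⟩
    rw [← compl_compl e, hj]
    ext i; simp
  · rintro ⟨j, rfl⟩
    exact ⟨Finset.subset_univ _, card_univ_erase j⟩

theorem univ_erase_injective :
    Function.Injective fun j : Fin n => (Finset.univ : Finset (Fin n)).erase j := by
  intro i j h
  by_contra hij
  have : i ∈ (Finset.univ : Finset (Fin n)).erase j := Finset.mem_erase.2 ⟨hij, Finset.mem_univ i⟩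
  simp only at h
  rw [← h] at this
  exact Finset.notMem_erase _ _ this

theorem completeHypergraph_eq_image (hn : 1 ≤ n) :
    completeHypergraph n = Finset.univ.image fun j : Fin n => Finset.univ.erase j := by
  ext e
  rw [mem_completeHypergraph hn]
  simp [eq_comm]

theorem prod_completeHypergraph (hn : 1 ≤ n) {R : Type*} [CommMonoid R]
    (f : Finset (Fin n) → R) :
    ∏ e ∈ completeHypergraph n, f e = ∏ j : Fin n, f (Finset.univ.erase j) := by
  rw [completeHypergraph_eq_image hn, Finset.prod_image univ_erase_injective.injOn]

/-- Padding with `1` turns a product over a subfamily into one over all missing vertices, so that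
replacement always runs over full products. -/
theorem prod_of_subset_completeHypergraph (hn : 1 ≤ n) {R : Type*} [CommMonoid R]
    {G : Finset (Finset (Fin n))} (hG : G ⊆ completeHypergraph n) (f : Finset (Fin n) → R) :
    ∏ e ∈ G, f e = ∏ j : Fin n, if Finset.univ.erase j ∈ G then f (Finset.univ.erase j) else 1 := by
  rw [← prod_completeHypergraph hn fun e => if e ∈ G then f e else 1]
  rw [Finset.prod_ite_mem, Finset.inter_eq_right.2 hG]

theorem prod_of_subset_erase (hn : 1 ≤ n) {R : Type*} [CommMonoid R] {j : Fin n}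
    {G : Finset (Finset (Fin n))} (hG : G ⊆ (completeHypergraph n).erase (Finset.univ.erase j))
    (f : Finset (Fin n) → R) :
    ∏ e ∈ G, f e = ∏ i ∈ Finset.univ.erase j,
      if Finset.univ.erase i ∈ G then f (Finset.univ.erase i) else 1 := by
  rw [prod_of_subset_completeHypergraph hn (hG.trans (Finset.erase_subset _ _)),
    ← Finset.mul_prod_erase _ _ (Finset.mem_univ j), if_neg, one_mul]
  exact fun h => Finset.notMem_erase _ _ (hG h)

variable {X : Fin n → Type u}

theorem glue_univ_erase {ℓ : ℕ} [NeZero ℓ] (j : Fin n) (k : Fin ℓ) (z : Copies X ℓ) :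
    glue (Finset.univ.erase j) (proj _ (origin z)) (fun i => z i k) = origin (freeze j k z) := by
  funext i
  by_cases h : i = j
  · subst h; simp [glue, origin, freeze]
  · simp [glue, origin, freeze, proj, h]

variable [∀ i, MeasurableSpace (X i)]

theorem measurable_of_sigmaAlg {e : Finset (Fin n)} {f : ((i : Fin n) → X i) → ℝ}
    (hf : Measurable[sigmaAlg X e] f) : Measurable f :=
  hf.mono (measurable_proj e).comap_le le_rfl

theorem sigmaAlg_update_eq {e : Finset (Fin n)} {i : Fin n} (hi : i ∉ e)
    {f : ((i : Fin n) → X i) → ℝ} (hf : Measurable[sigmaAlg X e] f) (x : (i : Fin n) → X i)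
    (a : X i) : f (Function.update x i a) = f x := by
  obtain ⟨F, -, rfl⟩ := Measurable.exists_eq_measurable_comp hf
  simp only [Function.comp]
  congr 1
  funext k
  have : (k : Fin n) ≠ i := fun h => hi (h ▸ k.2)
  simp [proj, this]

variable (μ : (i : Fin n) → Measure (X i)) [∀ i, IsProbabilityMeasure (μ i)] {ℓ : ℕ} [NeZero ℓ]

theorem holderBounded_of_boxNormLp_le [∀ i, Nonempty (X i)] {p : ℝ≥0∞} {s : ℝ} (hs : 1 ≤ s)
    (hsp : ENNReal.ofReal s ≤ p) {i : Fin n} {f : ((i : Fin n) → X i) → ℝ}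
    (hf : Measurable[sigmaAlg X (Finset.univ.erase i)] f) {K : ℝ≥0∞} (hK : K < ⊤)
    (h : boxNormLp μ (Finset.univ.erase i) ℓ p (descend _ f) ≤ K) :
    HolderBounded μ ℓ s K i f := by
  obtain ⟨hm, hd⟩ := descend_comp_proj _ f hf
  refine ⟨measurable_of_sigmaAlg hf, sigmaAlg_update_eq (Finset.notMem_erase _ _) hf, ?_⟩
  have := lintegral_dup_rpow_le_of_boxNormLp_le μ hs hsp hm hK h
  rw [card_univ_erase] at this
  rw [hd]
  exact this

theorem boxBounded_sub_of_boxNorm_le [∀ i, Nonempty (X i)] (hn : 2 ≤ n) (heven : Even ℓ) {i : Fin n}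
    {f g : ((i : Fin n) → X i) → ℝ} (hf : Measurable[sigmaAlg X (Finset.univ.erase i)] f)
    (hg : Measurable[sigmaAlg X (Finset.univ.erase i)] g) {a : ℝ≥0∞} (ha : a < ⊤)
    (h : boxNorm μ (Finset.univ.erase i) ℓ (fun x => descend _ f x - descend _ g x) ≤ a) :
    BoxBounded μ ℓ a i fun x => f x - g x := by
  obtain ⟨hm, hd⟩ := descend_comp_proj _ f hf
  obtain ⟨hm', hd'⟩ := descend_comp_proj _ g hg
  have he : (Finset.univ.erase i).Nonempty := by
    rw [← Finset.card_pos, card_univ_erase]; omega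
  have := integrable_and_enorm_integral_le_of_boxNorm_le μ heven he (hm.sub hm') ha h
  rw [card_univ_erase] at this
  refine ⟨(measurable_of_sigmaAlg hf).sub (measurable_of_sigmaAlg hg), fun x b => ?_, ?_, ?_⟩
  · rw [sigmaAlg_update_eq (Finset.notMem_erase _ _) hf,
      sigmaAlg_update_eq (Finset.notMem_erase _ _) hg]
  · rw [hd, hd']; exact this.1
  · rw [hd, hd']; exact this.2

theorem boxBounded_zero (a : ℝ≥0∞) (i : Fin n) : BoxBounded μ ℓ a i fun _ => 0 := by
  have h : dup (Finset.univ.erase i) (fun _ : Copies X ℓ => (0 : ℝ)) = fun _ => 0 := by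
    funext z
    have : (choices (ℓ := ℓ) (Finset.univ.erase i)).card ≠ 0 := by
      rw [card_choices]; exact pow_ne_zero _ (NeZero.ne ℓ)
    simp only [dup, Finset.prod_const, zero_pow this]
  refine ⟨measurable_const, fun _ _ => rfl, ?_, ?_⟩ <;> simp [h]

end Complete

/-! ### Specialising the linear forms condition. -/

section Hypotheses

variable {n : ℕ} {X : Fin n → Type u} [∀ i, MeasurableSpace (X i)] [∀ i, Nonempty (X i)]
  (μ : (i : Fin n) → Measure (X i)) [∀ i, IsProbabilityMeasure (μ i)] {ℓ : ℕ} [NeZero ℓ]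
  {ψ : Finset (Fin n) → ((i : Fin n) → X i) → ℝ}

/-- The integrand of the linear forms condition. -/
def linearForm (ψ : Finset (Fin n) → ((i : Fin n) → X i) → ℝ)
    (N : (e : Finset (Fin n)) → (e → Fin ℓ) → ℕ) (x : Fin ℓ → (i : Fin n) → X i) : ℝ :=
  ∏ e ∈ completeHypergraph n, ∏ ω : e → Fin ℓ,
    descend e (ψ e) (mix ω fun k => proj e (x k)) ^ N e ω

omit [NeZero ℓ] in
theorem measurable_linearForm
    (hψ : ∀ e ∈ completeHypergraph n, Measurable[sigmaAlg X e] (ψ e))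
    (N : (e : Finset (Fin n)) → (e → Fin ℓ) → ℕ) : Measurable (linearForm ψ N) := by
  refine Finset.measurable_fun_prod _ fun e he => Finset.measurable_fun_prod _ fun ω _ => ?_
  refine ((descend_comp_proj e (ψ e) (hψ e he)).1.comp ?_).pow_const _
  unfold mix proj; fun_prop

omit [NeZero ℓ] in
theorem integral_linearForm
    (hψ : ∀ e ∈ completeHypergraph n, Measurable[sigmaAlg X e] (ψ e))
    (N : (e : Finset (Fin n)) → (e → Fin ℓ) → ℕ) :
    ∫ x, linearForm ψ N x ∂(Measure.pi fun _ : Fin ℓ => Measure.pi μ) =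
      ∫ z : Copies X ℓ, linearForm ψ N (fun k i => z i k) ∂(copyMeasure μ ℓ) := by
  have h := measurePreserving_copies (ℓ := ℓ) μ (Function.injective_id (α := Fin n))
  have hm := measurable_linearForm hψ N
  simp only [id] at h
  rw [← h.map_eq, integral_map h.measurable.aemeasurable hm.aestronglyMeasurable]

open Classical in
/-- The choice of the `0`-th copies, for the edges in `G`. -/
theorem exists_linearForm_eq_prod (hn : 1 ≤ n)
    (hψ : ∀ e ∈ completeHypergraph n, Measurable[sigmaAlg X e] (ψ e))
    (G : Finset (Finset (Fin n))) :
    ∃ N : (e : Finset (Fin n)) → (e → Fin ℓ) → ℕ, (∀ e ω, N e ω = 0 ∨ N e ω = 1) ∧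
      ∀ z : Copies X ℓ, linearForm ψ N (fun k i => z i k) =
        ∏ i, (if Finset.univ.erase i ∈ G then ψ (Finset.univ.erase i) else fun _ => 1)
          (origin z) := by
  refine ⟨fun e ω => if e ∈ G ∧ ω = 0 then 1 else 0, fun e ω => by dsimp only; split_ifs <;> simp,
    fun z => ?_⟩
  unfold linearForm
  rw [prod_completeHypergraph hn]
  refine Finset.prod_congr rfl fun i _ => ?_
  have hd := (descend_comp_proj _ _
    (hψ (Finset.univ.erase i) ((mem_completeHypergraph hn).2 ⟨i, rfl⟩))).2
  by_cases hi : Finset.univ.erase i ∈ G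
  · rw [if_pos hi, Finset.prod_eq_single 0 (fun ω _ hω => by simp [hω]) (by simp)]
    conv_rhs => rw [hd]
    simp only [hi, true_and, if_true, pow_one]
    rfl
  · simp [hi]

open Classical in
/-- The choice of all copies of the coordinate `j` and of the `0`-th copies of the others, for the
edges in `G`. -/
theorem exists_linearForm_eq_prod_freeze (hn : 1 ≤ n)
    (hψ : ∀ e ∈ completeHypergraph n, Measurable[sigmaAlg X e] (ψ e)) {j : Fin n}
    {G : Finset (Finset (Fin n))}
    (hG : G ⊆ (completeHypergraph n).erase (Finset.univ.erase j)) :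
    ∃ N : (e : Finset (Fin n)) → (e → Fin ℓ) → ℕ, (∀ e ω, N e ω = 0 ∨ N e ω = 1) ∧
      ∀ z : Copies X ℓ, linearForm ψ N (fun k i => z i k) =
        ∏ i ∈ Finset.univ.erase j, ∏ k, (if Finset.univ.erase i ∈ G then ψ (Finset.univ.erase i)
          else fun _ => 1) (origin (freeze j k z)) := by
  refine ⟨fun e ω => if e ∈ G ∧ ∀ i : e, (i : Fin n) ≠ j → ω i = 0 then 1 else 0,
    fun e ω => by dsimp only; split_ifs <;> simp, fun z => ?_⟩
  unfold linearForm
  rw [prod_completeHypergraph hn, ← Finset.mul_prod_erase _ _ (Finset.mem_univ j)]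
  have hj : Finset.univ.erase j ∉ G := fun h => Finset.notMem_erase _ _ (hG h)
  rw [Finset.prod_eq_one (fun ω _ => by simp [hj]), one_mul]
  refine Finset.prod_congr rfl fun i hi => ?_
  have hij := Finset.ne_of_mem_erase hi
  have hd := (descend_comp_proj _ _
    (hψ (Finset.univ.erase i) ((mem_completeHypergraph hn).2 ⟨i, rfl⟩))).2
  by_cases hiG : Finset.univ.erase i ∈ G
  swap
  · simp [hiG]
  have hje : j ∈ Finset.univ.erase i := Finset.mem_erase.2 ⟨hij.symm, Finset.mem_univ j⟩
  symm
  -- The surviving vertices are those equal to some `k` at `j` and to `0` elsewhere; the others have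
  -- exponent `0`.
  refine Fintype.prod_of_injective
    (fun (k : Fin ℓ) (i' : (Finset.univ.erase i : Finset (Fin n))) => if (i' : Fin n) = j then k else 0)
    (fun k k' hk => by simpa using congrFun hk ⟨j, hje⟩) _ _ (fun ω hω => ?_) (fun k => ?_)
  · dsimp only
    rw [if_neg, pow_zero]
    rintro ⟨-, h⟩
    refine hω ⟨ω ⟨j, hje⟩, ?_⟩
    funext i'
    by_cases hi' : (i' : Fin n) = j
    · have : i' = ⟨j, hje⟩ := Subtype.ext hi'
      simp [this]
    · simp [hi', h i' hi']
  · dsimp only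
    rw [if_pos hiG, if_pos (c := _ ∧ _) ⟨hiG, fun i' hi' => by simp [hi']⟩, pow_one]
    conv_lhs => rw [hd]
    simp only [Function.comp]
    congr 1
    funext i'
    by_cases hi' : (i' : Fin n) = j
    · have : i' = ⟨j, hje⟩ := Subtype.ext hi'
      subst this
      simp [proj, mix, origin, freeze]
    · simp [proj, mix, origin, freeze, hi']

end Hypotheses

/-! ### Fibre averages over a single missing coordinate. -/

section FibreAverages

variable {n : ℕ} {X : Fin n → Type u} [∀ i, MeasurableSpace (X i)]
  (μ : (i : Fin n) → Measure (X i)) [∀ i, IsProbabilityMeasure (μ i)] {ℓ : ℕ} [NeZero ℓ]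

/-- The complement of the edge is the single vertex `j`, so choosing the `k`-th point of the fibre
amounts to freezing `j` at its `k`-th copy. -/
theorem integral_mul_prod_fibre_univ_erase {j : Fin n} {F : ProdSpace X (Finset.univ.erase j) → ℝ}
    (hF : Measurable F) {g : Fin n → Fin ℓ → ((i : Fin n) → X i) → ℝ}
    (hg : ∀ i ≠ j, ∀ k, Measurable (g i k))
    (hint : Integrable (fun z : Copies X ℓ => F (proj _ (origin z)) *
      ∏ i ∈ Finset.univ.erase j, ∏ k, g i k (origin (freeze j k z))) (copyMeasure μ ℓ)) :
    Integrable (fun x => F x * ∏ k, ∫ y, ∏ i ∈ Finset.univ.erase j,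
      g i k (glue _ x y) ∂(prodMeasure μ (Finset.univ.erase j)ᶜ))
      (prodMeasure μ (Finset.univ.erase j)) ∧
    ∫ x, F x * ∏ k, ∫ y, ∏ i ∈ Finset.univ.erase j, g i k (glue _ x y)
      ∂(prodMeasure μ (Finset.univ.erase j)ᶜ) ∂(prodMeasure μ (Finset.univ.erase j)) =
    ∫ z : Copies X ℓ, F (proj _ (origin z)) *
      ∏ i ∈ Finset.univ.erase j, ∏ k, g i k (origin (freeze j k z)) ∂(copyMeasure μ ℓ) := by
  have hcomm : ∀ z : Copies X ℓ,
      ∏ i ∈ Finset.univ.erase j, ∏ k, g i k (origin (freeze j k z)) =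
      ∏ k, ∏ i ∈ Finset.univ.erase j,
        g i k (glue (Finset.univ.erase j) (proj _ (origin z)) fun i => z i k) := fun z => by
    rw [Finset.prod_comm]; simp only [glue_univ_erase]
  simp only [hcomm] at hint ⊢
  exact integrable_and_integral_mul_prod_fibre μ (Finset.univ.erase j) hF
    (Φ := fun k x => ∏ i ∈ Finset.univ.erase j, g i k x)
    (fun k => Finset.measurable_fun_prod _ fun i hi => hg i (Finset.ne_of_mem_erase hi) k) hint

end FibreAverages

/-! ### The cut norm and the conditions on fibre averages. -/

section Pseudorandomness

variable {n : ℕ} {X : Fin n → Type u} [∀ i, MeasurableSpace (X i)]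
  {μ : (i : Fin n) → Measure (X i)} [∀ i, IsProbabilityMeasure (μ i)] {ℓ : ℕ} [NeZero ℓ]
  {s : ℝ} {K δ : ℝ≥0∞} {ε : ℝ}

theorem boundary_univ_erase (hn : 2 ≤ n) (j : Fin n) :
    boundary (Finset.univ.erase j) =
      (Finset.univ.erase j).image fun i => (Finset.univ.erase j).erase i := by
  ext t
  simp only [boundary, Finset.mem_powersetCard, Finset.mem_image]
  constructor
  · rintro ⟨ht, hc⟩
    have hc1 : ((Finset.univ.erase j) \ t).card = 1 := by
      rw [Finset.card_sdiff_of_subset ht, hc, card_univ_erase]; omega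
    obtain ⟨i, hi⟩ := Finset.card_eq_one.1 hc1
    refine ⟨i, (Finset.mem_sdiff.1 (hi ▸ Finset.mem_singleton_self i)).1, ?_⟩
    rw [← Finset.sdiff_singleton_eq_erase, ← hi, Finset.sdiff_sdiff_eq_self ht]
  · rintro ⟨i, hi, rfl⟩
    exact ⟨Finset.erase_subset _ _, Finset.card_erase_of_mem hi⟩

theorem abs_le_of_enorm_le (hε : 0 ≤ ε) {x : ℝ} (h : ‖x‖ₑ ≤ ENNReal.ofReal ε) : |x| ≤ ε := by
  rwa [← Real.norm_eq_abs, ← ENNReal.ofReal_le_ofReal_iff hε, ofReal_norm]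

/-- The indicator of a cut set is the product of the indicators of the sets `A (e.erase i)`. The
`i`-th one ignores `i` and is at most `1`, so it is an admissible factor. -/
theorem BoxBounded.cutNorm_le (heven : Even ℓ) (hℓ : 1 < ℓ)
    (hs : s.HolderConjugate ℓ) (hK : K < ⊤) (hK1 : 1 ≤ K) (hε : 0 ≤ ε)
    (hδ : δ * K ^ (ℓ * (n - 1)) ≤ ENNReal.ofReal ε) (hn : 2 ≤ n) {j : Fin n}
    {F : ((i : Fin n) → X i) → ℝ} (hF : BoxBounded μ ℓ δ j F) :
    cutNorm μ (Finset.univ.erase j) F ≤ ε := by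
  refine Real.sSup_le ?_ hε
  rintro _ ⟨S, ⟨A, hA, rfl⟩, rfl⟩
  have hA' : ∀ i ≠ j, MeasurableSet[sigmaAlg X ((Finset.univ.erase j).erase i)]
      (A ((Finset.univ.erase j).erase i)) := fun i hi => hA _ (by
    rw [boundary_univ_erase hn]
    exact Finset.mem_image_of_mem _ (Finset.mem_erase.2 ⟨hi, Finset.mem_univ i⟩))
  let g : Fin n → ((i : Fin n) → X i) → ℝ := fun i =>
    (A ((Finset.univ.erase j).erase i)).indicator fun _ => 1
  have hg : ∀ i ≠ j, HolderBounded μ ℓ s K i (g i) := fun i hi => by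
    have hm : Measurable[sigmaAlg X ((Finset.univ.erase j).erase i)] (g i) :=
      (@measurable_const _ _ _ (sigmaAlg X ((Finset.univ.erase j).erase i)) (1 : ℝ)).indicator
        (hA' i hi)
    refine (holderBounded_one hK1 hs.nonneg i).mono hs.nonneg (measurable_of_sigmaAlg hm)
      (sigmaAlg_update_eq (Finset.notMem_erase _ _) hm) fun x => ?_
    simp only [g]
    by_cases hx : x ∈ A ((Finset.univ.erase j).erase i) <;> simp [hx]
  have h := (hF.integral_mul_prod_pi_le heven hℓ hs hK hK1 hg).2.trans hδ
  have hmS : MeasurableSet (⋂ e' ∈ boundary (Finset.univ.erase j), A e') :=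
    Finset.measurableSet_biInter _ fun e' he' => (measurable_proj e').comap_le _ (hA e' he')
  refine abs_le_of_enorm_le hε ?_
  rw [← integral_indicator hmS]
  have heq : ∀ x, (⋂ e' ∈ boundary (Finset.univ.erase j), A e').indicator F x =
      F x * ∏ i ∈ Finset.univ.erase j, g i x := fun x => by
    have hx : x ∈ (⋂ e' ∈ boundary (Finset.univ.erase j), A e') ↔
        ∀ i ∈ Finset.univ.erase j, x ∈ A ((Finset.univ.erase j).erase i) := by
      rw [boundary_univ_erase hn]
      simp
    by_cases hxS : x ∈ ⋂ e' ∈ boundary (Finset.univ.erase j), A e'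
    · rw [Set.indicator_of_mem hxS, Finset.prod_eq_one fun i hi => ?_, mul_one]
      exact Set.indicator_of_mem (hx.1 hxS i hi) _
    · rw [Set.indicator_of_notMem hxS]
      rw [hx] at hxS
      push Not at hxS
      obtain ⟨i, hi, hxi⟩ := hxS
      rw [Finset.prod_eq_zero hi (Set.indicator_of_notMem hxi _), mul_zero]
  simp only [heq]
  exact h

theorem BoxBounded.integral_mul_prod_fibreAverage_le [∀ i, Nonempty (X i)] (heven : Even ℓ)
    (hℓ : 2 ≤ ℓ) (hs : s.HolderConjugate ℓ) (hK : K < ⊤) (hK1 : 1 ≤ K) (hε : 0 ≤ ε)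
    (hδ : δ * K ^ (ℓ * (n - 1)) ≤ ENNReal.ofReal ε) (hn : 1 ≤ n) {j : Fin n}
    {f f' : ((i : Fin n) → X i) → ℝ} (hf : Measurable[sigmaAlg X (Finset.univ.erase j)] f)
    (hf' : Measurable[sigmaAlg X (Finset.univ.erase j)] f')
    (hF : BoxBounded μ ℓ δ j fun x => f x - f' x)
    {g : Fin 2 → Finset (Fin n) → ((i : Fin n) → X i) → ℝ}
    (hg : ∀ k, ∀ i ≠ j, HolderBounded μ ℓ s K i (g k (Finset.univ.erase i))) :
    Integrable (fun x => (descend (Finset.univ.erase j) f x - descend _ f' x) *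
      ∏ k, fibreAverage μ (Finset.univ.erase j)
        ((completeHypergraph n).erase (Finset.univ.erase j)) (g k) x)
      (prodMeasure μ (Finset.univ.erase j)) ∧
    |∫ x, (descend (Finset.univ.erase j) f x - descend _ f' x) *
      ∏ k, fibreAverage μ (Finset.univ.erase j)
        ((completeHypergraph n).erase (Finset.univ.erase j)) (g k) x
      ∂(prodMeasure μ (Finset.univ.erase j))| ≤ ε := by
  -- The two given families fill the first two copies of `j`; at the remaining `ℓ - 2` copies the
  -- factors are `1`, whose fibre average is `1`.
  let u : Fin n → Fin ℓ → ((i : Fin n) → X i) → ℝ := fun i k =>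
    if h : (k : ℕ) < 2 then g ⟨k, h⟩ (Finset.univ.erase i) else fun _ => 1
  have hu : ∀ i ≠ j, ∀ k, HolderBounded μ ℓ s K i (u i k) := fun i hi k => by
    simp only [u]
    split_ifs with h
    · exact hg _ i hi
    · exact holderBounded_one hK1 hs.nonneg i
  obtain ⟨h1, h2⟩ := hF.integral_mul_prod_le heven (by omega) hs hK hu
  obtain ⟨hm, hd⟩ := descend_comp_proj _ f hf
  obtain ⟨hm', hd'⟩ := descend_comp_proj _ f' hf'
  have heq : ∀ x, f x - f' x = descend (Finset.univ.erase j) f (proj _ x) -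
      descend (Finset.univ.erase j) f' (proj _ x) := fun x =>
    congrArg₂ (· - ·) (congrFun hd x) (congrFun hd' x)
  simp only [heq] at h1 h2
  have hfib := integral_mul_prod_fibre_univ_erase μ (ℓ := ℓ)
    (F := fun x => descend (Finset.univ.erase j) f x - descend (Finset.univ.erase j) f' x)
    (hm.sub hm') (fun i hi k => (hu i hi k).measurable) h1
  have hprod : ∀ x, ∏ k, fibreAverage μ (Finset.univ.erase j)
      ((completeHypergraph n).erase (Finset.univ.erase j)) (g k) x =
      ∏ k, ∫ y, ∏ i ∈ Finset.univ.erase j, u i k (glue _ x y)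
        ∂(prodMeasure μ (Finset.univ.erase j)ᶜ) := fun x => by
    refine Fintype.prod_of_injective (Fin.castLE hℓ) (Fin.castLE_injective hℓ) _ _
      (fun k hk => ?_) fun k => ?_
    · have hk2 : ¬ (k : ℕ) < 2 := fun h => hk ⟨⟨k, h⟩, rfl⟩
      simp only [u, dif_neg hk2, Finset.prod_const_one, integral_const, smul_eq_mul, mul_one,
        probReal_univ]
    · unfold fibreAverage
      congr 1
      funext y
      rw [prod_of_subset_erase hn (Finset.Subset.refl _)]
      refine Finset.prod_congr rfl fun i hi => ?_
      have hmem : Finset.univ.erase i ∈ (completeHypergraph n).erase (Finset.univ.erase j) :=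
        Finset.mem_erase.2 ⟨fun h => Finset.ne_of_mem_erase hi (univ_erase_injective h),
          (mem_completeHypergraph hn).2 ⟨i, rfl⟩⟩
      rw [if_pos hmem]
      simp only [u]
      rw [dif_pos (show (Fin.castLE hℓ k : ℕ) < 2 from k.2)]
      rfl
  simp only [hprod]
  refine ⟨hfib.1, abs_le_of_enorm_le hε ?_⟩
  rw [hfib.2]
  exact h2.trans hδ

/-- With `F = 1`, the ℓ-th moment of a fibre average becomes an average over `ℓ` copies of `j`, in
which factors can be replaced one at a time. -/
theorem integral_fibreAverage_pow (hn : 1 ≤ n) {j : Fin n}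
    {G : Finset (Finset (Fin n))} (hG : G ⊆ (completeHypergraph n).erase (Finset.univ.erase j))
    {ν : Finset (Fin n) → ((i : Fin n) → X i) → ℝ} {u : Fin n → ((i : Fin n) → X i) → ℝ}
    (hu : ∀ i, u i = if Finset.univ.erase i ∈ G then ν (Finset.univ.erase i) else fun _ => 1)
    (hum : ∀ i ≠ j, Measurable (u i))
    (hint : Integrable (fun z : Copies X ℓ => ∏ i ∈ Finset.univ.erase j,
      ∏ k, u i (origin (freeze j k z))) (copyMeasure μ ℓ)) :
    Integrable (fun x => fibreAverage μ (Finset.univ.erase j) G ν x ^ ℓ)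
      (prodMeasure μ (Finset.univ.erase j)) ∧
    ∫ x, fibreAverage μ (Finset.univ.erase j) G ν x ^ ℓ ∂(prodMeasure μ (Finset.univ.erase j)) =
      ∫ z : Copies X ℓ, ∏ i ∈ Finset.univ.erase j, ∏ k, u i (origin (freeze j k z))
        ∂(copyMeasure μ ℓ) := by
  have h := integral_mul_prod_fibre_univ_erase μ (ℓ := ℓ) (j := j) (F := fun _ => 1)
    measurable_const (g := fun i _ => u i) (fun i hi _ => hum i hi) (by simpa using hint)
  have hfib : ∀ x, fibreAverage μ (Finset.univ.erase j) G ν x =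
      ∫ y, ∏ i ∈ Finset.univ.erase j, u i (glue _ x y)
        ∂(prodMeasure μ (Finset.univ.erase j)ᶜ) := fun x => by
    unfold fibreAverage
    congr 1
    funext y
    rw [prod_of_subset_erase hn hG]
    refine Finset.prod_congr rfl fun i _ => ?_
    rw [hu i]
    split_ifs <;> rfl
  simp only [one_mul, Finset.prod_const, Finset.card_univ, Fintype.card_fin, ← hfib] at h
  exact h

end Pseudorandomness

end HypergraphSystem

end

/-! ### Verification of the pseudorandomness conditions. -/

open HypergraphSystem

theorem theorem4p3 {n : ℕ} (hn : 3 ≤ n) {C : ℝ} (hC : 1 ≤ C) {p : ENNReal} (hp : 1 < p)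
    {ℓ : ℕ} (hℓ : ℓ = boxLevel C p) {η : ℝ} (hη0 : 0 < η) (hη1 : η ≤ 1 / (n * ℓ))
    {X : Fin n → Type*} [∀ i, MeasurableSpace (X i)]
    (μ : (i : Fin n) → MeasureTheory.Measure (X i))
    [∀ i, MeasureTheory.IsProbabilityMeasure (μ i)]
    (ν ψ : Finset (Fin n) → ((i : Fin n) → X i) → ℝ)
    (hν : ∀ e ∈ completeHypergraph n, MemLpAlg μ e 1 (ν e))
    (hψ : ∀ e ∈ completeHypergraph n, MemLpAlg μ e p (ψ e))
    (hν0 : ∀ e ∈ completeHypergraph n, ∀ x, 0 ≤ ν e x)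
    (hψ0 : ∀ e ∈ completeHypergraph n, ∀ x, 0 ≤ ψ e x)
    (hI : ∀ N : (e : Finset (Fin n)) → (e → Fin ℓ) → ℕ, (∀ e ω, N e ω = 0 ∨ N e ω = 1) →
      1 - η ≤ ∫ x : Fin ℓ → (i : Fin n) → X i,
          ∏ e ∈ completeHypergraph n, ∏ ω : e → Fin ℓ,
            descend e (ψ e) (mix ω fun k => proj e (x k)) ^ N e ω
          ∂(MeasureTheory.Measure.pi fun _ => MeasureTheory.Measure.pi μ) ∧
      ∫ x : Fin ℓ → (i : Fin n) → X i,
          ∏ e ∈ completeHypergraph n, ∏ ω : e → Fin ℓ,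
            descend e (ψ e) (mix ω fun k => proj e (x k)) ^ N e ω
          ∂(MeasureTheory.Measure.pi fun _ => MeasureTheory.Measure.pi μ) ≤ C + η)
    (hνnorm : ∀ e ∈ completeHypergraph n,
      1 ≤ boxNormLp μ e ℓ p (descend e (ν e)) ∧ boxNormLp μ e ℓ p (descend e (ν e)) < ⊤)
    (hψnorm : ∀ e ∈ completeHypergraph n,
      boxNormLp μ e ℓ p (descend e (ψ e)) ≤ ENNReal.ofReal C)
    {M : ℝ} (hM : IsGreatest
      ((fun e => (boxNormLp μ e ℓ p (descend e (ν e))).toReal) ''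
        (completeHypergraph n : Set (Finset (Fin n)))) M)
    (hdiff : ∀ e ∈ completeHypergraph n,
      boxNorm μ e ℓ (fun x => descend e (ν e) x - descend e (ψ e) x) ≤
        ENNReal.ofReal (η * ((C * M) ^ ((n - 1) * ℓ))⁻¹)) :
    IsPseudorandom μ (completeHypergraph n) C (n * ℓ * η) p ν := by
  obtain ⟨heven, hℓ2, hsp⟩ := boxLevel_spec hC hp
  rw [← hℓ] at heven hℓ2 hsp
  have hℓ0 : NeZero ℓ := ⟨by omega⟩
  have hn0 : NeZero n := ⟨by omega⟩
  have hne : ∀ i, Nonempty (X i) := fun i => (μ i).nonempty_of_neZero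
  have hs : (ℓ : ℝ).conjExponent.HolderConjugate ℓ :=
    (Real.HolderConjugate.conjExponent (by exact_mod_cast hℓ2)).symm
  set s := (ℓ : ℝ).conjExponent
  have hn1 : 1 ≤ n := by omega
  have hmem : ∀ i : Fin n, Finset.univ.erase i ∈ completeHypergraph n := fun i =>
    (mem_completeHypergraph hn1).2 ⟨i, rfl⟩
  have hM1 : 1 ≤ M := by
    obtain ⟨e, he, rfl⟩ := hM.1
    rw [← ENNReal.toReal_one]
    exact ENNReal.toReal_mono (hνnorm e he).2.ne (hνnorm e he).1
  have hCM : 1 ≤ C * M := one_le_mul_of_one_le_of_one_le hC hM1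
  -- Since `C, M ≥ 1`, the product dominates both `M`, which bounds the norms of `ν`, and `C`, which
  -- bounds those of `ψ`.
  set K : ENNReal := ENNReal.ofReal (C * M)
  have hK : K < ⊤ := ENNReal.ofReal_lt_top
  have hK1 : 1 ≤ K := ENNReal.one_le_ofReal.2 hCM
  have hνK : ∀ i, HolderBounded μ ℓ s K i (ν (Finset.univ.erase i)) := fun i => by
    refine holderBounded_of_boxNormLp_le μ hs.lt.le hsp (hν _ (hmem i)).1 hK ?_
    rw [← ENNReal.ofReal_toReal (hνnorm _ (hmem i)).2.ne]
    exact ENNReal.ofReal_le_ofReal ((hM.2 ⟨_, hmem i, rfl⟩).trans (by nlinarith))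
  have hψK : ∀ i, HolderBounded μ ℓ s K i (ψ (Finset.univ.erase i)) := fun i =>
    holderBounded_of_boxNormLp_le μ hs.lt.le hsp (hψ _ (hmem i)).1 hK
      ((hψnorm _ (hmem i)).trans (ENNReal.ofReal_le_ofReal (by nlinarith)))
  set δ : ENNReal := ENNReal.ofReal (η * ((C * M) ^ ((n - 1) * ℓ))⁻¹)
  have hdδ : ∀ i, BoxBounded μ ℓ δ i fun x =>
      ν (Finset.univ.erase i) x - ψ (Finset.univ.erase i) x := fun i =>
    boxBounded_sub_of_boxNorm_le μ (by omega) heven (hν _ (hmem i)).1 (hψ _ (hmem i)).1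
      ENNReal.ofReal_lt_top (hdiff _ (hmem i))
  -- The power of `C * M` in the hypothesis on `ν - ψ` cancels exactly, so one replacement costs
  -- `η`.
  have hδ : δ * K ^ (ℓ * (n - 1)) ≤ ENNReal.ofReal η := by
    rw [← ENNReal.ofReal_pow (by linarith), ← ENNReal.ofReal_mul (by positivity), mul_comm ℓ,
      inv_mul_cancel_right₀ (by positivity)]
  have hnR : (3 : ℝ) ≤ n := by exact_mod_cast hn
  have hℓR : (2 : ℝ) ≤ ℓ := by exact_mod_cast hℓ2
  -- The budget for (C1): `n` replacements and the error `η` of the linear forms condition.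
  have hnη : n * η + η ≤ n * ℓ * η := by
    have h1 := mul_le_mul_of_nonneg_right (mul_le_mul_of_nonneg_left hℓR (by positivity : 0 ≤ (n : ℝ)))
      hη0.le
    have h2 := mul_le_mul_of_nonneg_right hnR hη0.le
    linarith
  have hη' : η ≤ n * ℓ * η := by
    have : 0 ≤ n * η := by positivity
    linarith
  have hψm : ∀ e ∈ completeHypergraph n, Measurable[sigmaAlg X e] (ψ e) := fun e he => (hψ e he).1
  -- The factors for the edges in `G`, and constant factors for the other edges.
  let u : Finset (Finset (Fin n)) → (Finset (Fin n) → ((i : Fin n) → X i) → ℝ) → Fin n →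
      ((i : Fin n) → X i) → ℝ := fun G f i =>
    if Finset.univ.erase i ∈ G then f (Finset.univ.erase i) else fun _ => 1
  have huν : ∀ G i, HolderBounded μ ℓ s K i (u G ν i) := fun G i => by
    simp only [u]; split_ifs
    · exact hνK i
    · exact holderBounded_one hK1 hs.nonneg i
  have huψ : ∀ G i, HolderBounded μ ℓ s K i (u G ψ i) := fun G i => by
    simp only [u]; split_ifs
    · exact hψK i
    · exact holderBounded_one hK1 hs.nonneg i
  have hud : ∀ G i, BoxBounded μ ℓ δ i fun x => u G ν i x - u G ψ i x := fun G i => by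
    simp only [u]; split_ifs
    · exact hdδ i
    · simpa using boxBounded_zero μ δ i
  refine ⟨⟨n - 1, by omega, by omega, fun e he => ?_⟩, hν, hν0, fun G hG _ => ?_,
    fun e he => ?_, fun e he G hG _ => ?_⟩
  · exact (Finset.mem_powersetCard.1 he).2
  · have hprod : ∀ x, ∏ e ∈ G, ν e x = ∏ i, u G ν i x := fun x => by
      rw [prod_of_subset_completeHypergraph hn1 hG]
      refine Finset.prod_congr rfl fun i _ => ?_
      simp only [u]; split_ifs <;> rfl
    simp only [hprod]
    obtain ⟨h1, h2⟩ := abs_integral_prod_sub_le heven hℓ2 hs hK hη0.le hδ hK1 (huν G) (huψ G)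
      (hud G)
    refine ⟨h1, ?_⟩
    obtain ⟨N, hN, hNeq⟩ := exists_linearForm_eq_prod (ℓ := ℓ) hn1 hψm G
    have h3 := (hI N hN).1
    change 1 - η ≤ ∫ x, linearForm ψ N x ∂(MeasureTheory.Measure.pi fun _ : Fin ℓ => _) at h3
    rw [integral_linearForm μ hψm] at h3
    simp only [hNeq] at h3
    have hmp := measurePreserving_origin (ℓ := ℓ) μ
    have hm : Measurable fun x => ∏ i, u G ψ i x :=
      Finset.measurable_fun_prod _ fun i _ => (huψ G i).measurable
    have h4 := MeasureTheory.integral_map (μ := copyMeasure μ ℓ) hmp.measurable.aemeasurable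
      (f := fun x => ∏ i, u G ψ i x) (hm.aestronglyMeasurable)
    rw [hmp.map_eq] at h4
    have h5 := (abs_le.1 h2).1
    rw [h4] at h5
    have h6 : (1 : ℝ) - η ≤ ∫ z : Copies X ℓ, ∏ i, u G ψ i (origin z) ∂(copyMeasure μ ℓ) := h3
    linarith
  · obtain ⟨j, rfl⟩ := (mem_completeHypergraph hn1).1 he
    obtain ⟨hm, hd⟩ := descend_comp_proj _ _ (hψ _ he).1
    have hε : 0 ≤ n * ℓ * η := by positivity
    have hδ' : δ * K ^ (ℓ * (n - 1)) ≤ ENNReal.ofReal (n * ℓ * η) :=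
      hδ.trans (ENNReal.ofReal_le_ofReal hη')
    -- The given `ψ` is the required majorant in (C2); both estimates hold with error `η`, weakened
    -- here to `n * ℓ * η`.
    refine ⟨ψ (Finset.univ.erase j), hψ _ he, ?_,
      (hdδ j).cutNorm_le heven hℓ2 hs hK hK1 hε hδ' (by omega), fun g hg => ?_⟩
    · rw [hd]
      exact eLpNorm_comp_proj_le_of_boxNormLp_le μ hℓ2 hp.le hm ENNReal.ofReal_lt_top
        (hψnorm _ he)
    · refine (hdδ j).integral_mul_prod_fibreAverage_le heven hℓ2 hs hK hK1 hε hδ' hn1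
        (hν _ he).1 (hψ _ he).1 fun k i hi => ?_
      obtain ⟨⟨hgm, -⟩, hgb⟩ := hg k (Finset.univ.erase i)
        (Finset.mem_erase.2 ⟨fun h => hi (univ_erase_injective h), hmem i⟩)
      have hgm' := measurable_of_sigmaAlg hgm
      have hgi := sigmaAlg_update_eq (Finset.notMem_erase i _) hgm
      rcases hgb with hgb | hgb
      · refine (hνK i).mono hs.nonneg hgm' hgi fun x => ?_
        rw [Real.enorm_of_nonneg (hgb x).1, Real.enorm_of_nonneg (hν0 _ (hmem i) x)]
        exact ENNReal.ofReal_le_ofReal (hgb x).2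
      · refine (holderBounded_one hK1 hs.nonneg i).mono hs.nonneg hgm' hgi fun x => ?_
        rw [Real.enorm_of_nonneg (hgb x).1, Real.enorm_of_nonneg zero_le_one]
        exact ENNReal.ofReal_le_ofReal (hgb x).2
  · obtain ⟨j, rfl⟩ := (mem_completeHypergraph hn1).1 he
    rw [← hℓ]
    obtain ⟨h1, h2⟩ := abs_integral_prod_prod_freeze_sub_le heven hℓ2 hs hK hη0.le hδ hK1
      (huν G) (huψ G) (hud G) (by omega) j
    obtain ⟨h3, h4⟩ := integral_fibreAverage_pow hn1 hG (ν := ν) (u := u G ν) (fun _ => rfl)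
      (fun i _ => (huν G i).measurable) h1
    refine ⟨h3, ?_⟩
    rw [h4]
    obtain ⟨N, hN, hNeq⟩ := exists_linearForm_eq_prod_freeze (ℓ := ℓ) hn1 hψm hG
    have h5 := (hI N hN).2
    change ∫ x, linearForm ψ N x ∂(MeasureTheory.Measure.pi fun _ : Fin ℓ => _) ≤ C + η at h5
    rw [integral_linearForm μ hψm] at h5
    simp only [hNeq] at h5
    have h6 : ∫ z : Copies X ℓ, ∏ i ∈ Finset.univ.erase j, ∏ k, u G ψ i (origin (freeze j k z))
      ∂(copyMeasure μ ℓ) ≤ C + η := h5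
    have h7 := (abs_le.1 h2).2
    push_cast [Nat.cast_sub hn1] at h7
    -- The total error is `(n - 1)ℓη + η`, at most `nℓη` because `ℓ ≥ 1`.
    nlinarith
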